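/- Conventions. A locale $X$ has a frame of opens $\mathcal{O}X$; a locale map $f\colon X\to Y$ is a frame homomorphism $f^*\colon\mathcal{O}Y\to\mathcal{O}X$. Write $a\between b$ if $a\wedge b\neq 0$. A strong cover is a set of nonzero opens with join $1$; covers are preordered by refinement ($U\le V$ if every $u\in U$ lies below some $v\in V$). Put $\mathrm{st}(a,U)=\bigvee\{u\in U\mid a\between u\}$, $U^\star=\{\mathrm{st}(u,U)\mid u\in U\}$, and write $a\vartriangleleft_U b$ if $\mathrm{st}(a,U)\le b$. A pre-uniform locale is a locale $X$ with a filter $\mathcal{U}$ (with respect to refinement) of strong covers such that every $U\in\mathcal{U}$ has some $V\in\mathcal{U}$ with $V^\star\le U$; write $a\vartriangleleft b$ if $a\vartriangleleft_U b$ for some $U\in\mathcal{U}$. A base is a set $\mathcal{B}\subseteq\mathcal{U}$ such that every $U\in\mathcal{U}$ is refined by some $V\in\mathcal{B}$. The completion $\mathcal{C}X$ (the locale of regular Cauchy filters) is given by the frame presentation with generators $[a\in F]$, $a\in\mathcal{O}X$, and relations $[1\in F]=1$; $[a\wedge b\in F]=[a\in F]\wedge[b\in F]$; $[0\in F]=0$;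 $\bigvee_{u\in U}[u\in F]=1$ for $U\in\mathcal{U}$; $[a\in F]\le\bigvee_{b\vartriangleleft a}[b\in F]$. The locale $\mathrm{Cauchy}(X)$ of modulated Cauchy sequences is given by generators $[s(n)\in u]$ ($n\in\mathbb{N}$, $u\in\mathcal{O}X$) and $[m(U)=k]$ ($U\in\mathcal{B}$, $k\in\mathbb{N}$) and relations $\bigvee_\alpha\bigwedge_{u\in F_\alpha}[s(n)\in u]=[s(n)\in\bigvee_\alpha\bigwedge F_\alpha]$ for every family of finite sets $F_\alpha\subseteq\mathcal{O}X$; $\bigvee_{k}[m(U)=k]=1$; and $[m(U)=k]\le\bigvee_{u\in U}[s(n)\in u]\wedge[s(n')\in u]$ for $n,n'\ge k$. Theorem. Let $X$ be a pre-uniform locale with base $\mathcal{B}$. (1) There is a unique frame homomorphism $q^*\colon\mathcal{O}\mathcal{C}X\to\mathcal{O}\mathrm{Cauchy}(X)$ with $$q^*([u\in F])=\bigvee_{U\in\mathcal{B}}\ \bigvee_{v\vartriangleleft_U u'\vartriangleleft u}\ \bigvee_{k'\le k}[m(U)=k']\wedge[s(k)\in v]\qquad(u\in\mathcal{O}X).$$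 It defines the limit map $q\colon\mathrm{Cauchy}(X)\to\mathcal{C}X$. (2) There is a unique suplattice homomorphism (i.e. map preserving arbitrary joins) $q_\#\colon\mathcal{O}\mathrm{Cauchy}(X)\to\mathcal{O}\mathcal{C}X$ such that, for all finite lists of distinct naturals $n_i$ with nonzero opens $u_i$ and all finite lists $U_j\in\mathcal{B}$, $k_j\in\mathbb{N}$, $$q_\#\Bigl(\bigwedge_i[s(n_i)\in u_i]\wedge\bigwedge_j[m(U_j)=k_j]\Bigr)=\bigvee_{(V_j)}\bigvee_{(v_i)}\bigwedge_i[v_i\in F],$$ where $(V_j)$ ranges over families in $\mathcal{B}$ with $V_j^\star\le U_j$ for all $j$, and $(v_i)$ over families in $\bigcup\mathcal{B}$ such that $v_i\between u_i$ for all $i$ and $v_i$ lies below some element of $V_j$ whenever $k_j\le n_i$. (3) $q_\#(1)=1$ and $q_\#(a\wedge q^*(b))=q_\#(a)\wedge b$ for all $a\in\mathcal{O}\mathrm{Cauchy}(X)$ and $b\in\mathcal{O}\mathcal{C}X$; that is, $q$ is a lower triquotient with triquotiency assignment $q_\#$. Consequently $q$ is a pullback-stable quotient of locales: every pullback of $q$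 along a locale map, and in particular $q$ itself, is a regular epimorphism in the category of locales. -/

import Mathlib

open CategoryTheory

universe u v w

/-! ### Frames presented by generators and relations -/

/-- The free frame on a set `G`: the frame of down-closed subsets of the free meet-semilattice on
`G`, which is the set of finite subsets of `G` ordered by reverse inclusion (the finite subset `S`
stands for the formal meet of its elements). -/
abbrev FreeFrame (G : Type u) : Type u := LowerSet (Finset G)ᵒᵈ

namespace FreeFrame

variable {G : Type u} {M : Type v} [Order.Frame M]

/-- The inclusion of the generators in the free frame. -/
def gen (g : G) : FreeFrame G := LowerSet.Iic (OrderDual.toDual {g})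

theorem mem_gen {g : G} {S : (Finset G)ᵒᵈ} :
    S ∈ gen g ↔ g ∈ OrderDual.ofDual S := by
  rw [gen, LowerSet.mem_Iic_iff, ← OrderDual.ofDual_le_ofDual]
  simp

open Classical in
/-- The frame homomorphism out of the free frame determined by a function on generators. -/
noncomputable def lift (f : G → M) : FrameHom (FreeFrame G) M where
  toFun a := ⨆ S ∈ a, (OrderDual.ofDual S).inf f
  map_inf' a b := by
    apply le_antisymm
    · refine iSup₂_le fun S hS => le_inf ?_ ?_
      · exact le_iSup₂_of_le S hS.1 le_rfl
      · exact le_iSup₂_of_le S hS.2 le_rfl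
    · simp only [iSup_inf_eq, inf_iSup_eq]
      refine iSup₂_le fun S hS => iSup₂_le fun T hT => ?_
      refine le_iSup₂_of_le
        (OrderDual.toDual (OrderDual.ofDual S ∪ OrderDual.ofDual T)) ⟨?_, ?_⟩ ?_
      · first
        | exact a.lower (show OrderDual.ofDual S ⊆ _ from Finset.subset_union_left) hS
        | exact a.lower (show OrderDual.ofDual T ⊆ _ from Finset.subset_union_right) hT
      · first
        | exact b.lower (show OrderDual.ofDual T ⊆ _ from Finset.subset_union_right) hT
        | exact b.lower (show OrderDual.ofDual S ⊆ _ from Finset.subset_union_left) hS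
      · simp [Finset.inf_union, inf_comm]
  map_top' := by
    refine top_unique (le_iSup₂_of_le (OrderDual.toDual ∅) trivial ?_)
    simp
  map_sSup' s := by
    apply le_antisymm
    · refine iSup₂_le fun S hS => ?_
      rw [LowerSet.mem_sSup_iff] at hS
      obtain ⟨a, ha, hSa⟩ := hS
      exact le_trans (le_iSup₂_of_le (f := fun S (_ : S ∈ a) => (OrderDual.ofDual S).inf f)
        S hSa le_rfl) (le_sSup (Set.mem_image_of_mem _ ha))
    · refine sSup_le ?_
      rintro _ ⟨a, ha, rfl⟩
      exact iSup₂_le fun S hS => le_iSup₂_of_le S (LowerSet.mem_sSup_iff.2 ⟨a, ha, hS⟩) le_rfl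

theorem lift_apply (f : G → M) (a : FreeFrame G) :
    lift f a = ⨆ S ∈ a, (OrderDual.ofDual S).inf f := rfl

@[simp] theorem lift_gen (f : G → M) (g : G) : lift f (gen g) = f g := by
  rw [lift_apply]
  apply le_antisymm
  · exact iSup₂_le fun S hS => Finset.inf_le (mem_gen.1 hS)
  · refine le_iSup₂_of_le (OrderDual.toDual {g}) (mem_gen.2 ?_) ?_ <;> simp

/-- Every element of the free frame is a join of finite meets of generators. -/
theorem eq_iSup (a : FreeFrame G) : a = ⨆ S ∈ a, (OrderDual.ofDual S).inf gen := by
  have key : ∀ S T : (Finset G)ᵒᵈ, T ∈ (OrderDual.ofDual S).inf gen ↔ T ≤ S := by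
    intro S T
    have h1 : T ∈ (OrderDual.ofDual S).inf gen ↔
        LowerSet.Iic T ≤ (OrderDual.ofDual S).inf gen := LowerSet.Iic_le.symm
    rw [h1, Finset.le_inf_iff]
    simp only [LowerSet.Iic_le, mem_gen]
    exact ⟨fun h => fun x hx => h x hx, fun h x hx => h hx⟩
  apply le_antisymm
  · intro S hS
    exact (le_iSup₂ (f := fun S (_ : S ∈ a) => (OrderDual.ofDual S).inf gen) S hS)
      ((key S S).2 le_rfl)
  · refine iSup₂_le fun S hS T hT => a.lower ((key S T).1 hT) hS

theorem hom_ext {h k : FrameHom (FreeFrame G) M} (H : ∀ g, h (gen g) = k (gen g)) : h = k := by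
  ext a
  rw [eq_iSup a]
  simp only [map_iSup, map_finset_inf]
  have : (h ∘ gen : G → M) = k ∘ gen := funext H
  rw [this]

end FreeFrame

/-- The frame presented by generators `G` and relations `a ≤ b` for `R a b`, where `a`, `b` are
elements of the free frame on `G`: the quotient of the free frame consisting of those `x` for which
`c ⊓ b ≤ x` implies `c ⊓ a ≤ x` for every relation `a ≤ b` and every `c`. -/
def presentedSublocale {G : Type u} (R : FreeFrame G → FreeFrame G → Prop) :
    Sublocale (FreeFrame G) where
  carrier := {x | ∀ a b, R a b → ∀ c, c ⊓ b ≤ x → c ⊓ a ≤ x}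
  sInf_mem' s hs a b hab c hc :=
    le_sInf fun x hx => hs hx a b hab c (hc.trans (sInf_le hx))
  himp_mem' y x hx a b hab c hc := by
    rw [le_himp_iff] at hc ⊢
    have := hx a b hab (c ⊓ y) (by rwa [inf_right_comm])
    rwa [inf_right_comm] at this

/-- The frame `⟨G ∣ R⟩`. -/
def PresentedFrame {G : Type u} (R : FreeFrame G → FreeFrame G → Prop) : Type u :=
  ↥(presentedSublocale R)

namespace PresentedFrame

variable {G : Type u} {R : FreeFrame G → FreeFrame G → Prop}

instance : Order.Frame (PresentedFrame R) :=
  inferInstanceAs (Order.Frame ↥(presentedSublocale R))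

/-- The quotient map from the free frame. -/
def mk (R : FreeFrame G → FreeFrame G → Prop) : FrameHom (FreeFrame G) (PresentedFrame R) :=
  (presentedSublocale R).restrict

/-- The generators of a presented frame. -/
def gen (R : FreeFrame G → FreeFrame G → Prop) (g : G) : PresentedFrame R :=
  mk R (FreeFrame.gen g)

theorem mk_le_iff {a : FreeFrame G} {x : PresentedFrame R} :
    mk R a ≤ x ↔ a ≤ (show ↥(presentedSublocale R) from x).1 :=
  (presentedSublocale R).giRestrict.gc a x

theorem mk_surjective : Function.Surjective (mk R) :=
  (presentedSublocale R).giRestrict.l_surjective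

/-- The relations hold in the presented frame. -/
theorem mk_le_mk {a b : FreeFrame G} (h : R a b) : mk R a ≤ mk R b := by
  rw [mk_le_iff]
  have := (show ↥(presentedSublocale R) from mk R b).2 a b h ⊤
    (by rw [top_inf_eq]; exact mk_le_iff.1 le_rfl)
  rwa [top_inf_eq] at this

/-- The universal property of the presented frame: functions on the generators respecting
the relations extend uniquely to frame homomorphisms. -/
theorem existsUnique_lift {M : Type v} [Order.Frame M] (f : G → M)
    (hf : ∀ a b, R a b → FreeFrame.lift f a ≤ FreeFrame.lift f b) :
    ∃! h : FrameHom (PresentedFrame R) M, ∀ g, h (gen R g) = f g := by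
  have key : ∀ a : FreeFrame G, FreeFrame.lift f
      (show ↥(presentedSublocale R) from mk R a).1 = FreeFrame.lift f a := by
    intro a
    apply le_antisymm
    · let r : FreeFrame G := sSup {x | FreeFrame.lift f x ≤ FreeFrame.lift f a}
      have hr : ∀ x, x ≤ r ↔ FreeFrame.lift f x ≤ FreeFrame.lift f a := by
        intro x
        refine ⟨fun hx => (OrderHomClass.mono (FreeFrame.lift f) hx).trans ?_,
          fun hx => le_sSup hx⟩
        simp only [r, map_sSup]
        exact sSup_le (by rintro _ ⟨y, hy, rfl⟩; exact hy)
      have hmem : r ∈ presentedSublocale R := by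
        intro b b' hb c hc
        rw [hr, map_inf] at hc ⊢
        exact (inf_le_inf_left _ (hf b b' hb)).trans hc
      have h1 : mk R a ≤ (show PresentedFrame R from ⟨r, hmem⟩) :=
        mk_le_iff.2 ((hr a).2 le_rfl)
      exact (hr _).1 h1
    · exact OrderHomClass.mono (FreeFrame.lift f) (mk_le_iff.1 le_rfl)
  have hval : ∀ x : PresentedFrame R,
      mk R (show ↥(presentedSublocale R) from x).1 = x :=
    fun x => (presentedSublocale R).giRestrict.l_u_eq x
  refine ⟨{ toFun := fun x => FreeFrame.lift f (show ↥(presentedSublocale R) from x).1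
            map_inf' := fun x y => map_inf (FreeFrame.lift f) _ _
            map_top' := map_top (FreeFrame.lift f)
            map_sSup' := ?_ }, ?_, ?_⟩
  · intro s
    have hs : sSup s = mk R
        (sSup ((fun x : PresentedFrame R => (show ↥(presentedSublocale R) from x).1) '' s)) := by
      rw [map_sSup, Set.image_image]
      simp only [hval, Set.image_id']
    rw [hs, key, map_sSup, Set.image_image]
  · intro g
    exact (key _).trans (FreeFrame.lift_gen f g)
  · intro h hh
    ext x
    obtain ⟨a, rfl⟩ := mk_surjective x
    have : h.comp (mk R) = FreeFrame.lift f :=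
      FreeFrame.hom_ext fun g => by
        rw [FreeFrame.lift_gen]
        exact hh g
    exact (DFunLike.congr_fun this a).trans (key a).symm

end PresentedFrame

/-! ### Pre-uniform locales -/

section Covers

variable {L : Type u} [Order.Frame L]

/-- `a ≬ b`: the open `a ⊓ b` is nonzero. -/
def Meets (a b : L) : Prop := ⊥ < a ⊓ b

/-- A strong cover: a set of nonzero opens with join `⊤`. -/
def IsStrongCover (U : Set L) : Prop := sSup U = ⊤ ∧ ∀ u ∈ U, ⊥ < u

/-- The refinement preorder `U ≤ V` on covers. -/
def Refines (U V : Set L) : Prop := ∀ u ∈ U, ∃ v ∈ V, u ≤ v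

/-- The star `st(a, U)` of an open. -/
def starOf (a : L) (U : Set L) : L := sSup {u ∈ U | Meets a u}

/-- The star `U⋆ = {st(u, U) ∣ u ∈ U}` of a cover. -/
def starCover (U : Set L) : Set L := {a | ∃ u ∈ U, a = starOf u U}

/-- `a ◁_U b`: the star `st(a, U)` lies below `b`. -/
def StarBelow (U : Set L) (a b : L) : Prop := starOf a U ≤ b

end Covers

/-- A uniformity on (the locale whose frame of opens is) `L`: a filter, with respect to refinement,
of strong covers in which every member has a star-refinement. -/
structure PreUniformity (L : Type u) [Order.Frame L] where
  /-- The uniform covers. -/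
  covers : Set (Set L)
  isStrongCover : ∀ U ∈ covers, IsStrongCover U
  nonempty : covers.Nonempty
  mem_of_refines : ∀ U ∈ covers, ∀ V, IsStrongCover V → Refines U V → V ∈ covers
  directed : ∀ U ∈ covers, ∀ V ∈ covers, ∃ W ∈ covers, Refines W U ∧ Refines W V
  exists_star_refines : ∀ U ∈ covers, ∃ V ∈ covers, Refines (starCover V) U

namespace PreUniformity

variable {L : Type u} [Order.Frame L]

/-- `B` is a base of the uniformity. -/
def IsBase (𝒰 : PreUniformity L) (B : Set (Set L)) : Prop :=
  B ⊆ 𝒰.covers ∧ ∀ U ∈ 𝒰.covers, ∃ V ∈ B, Refines V U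

/-- The uniformly below relation `a ◁ b`. -/
def UniformlyBelow (𝒰 : PreUniformity L) (a b : L) : Prop :=
  ∃ U ∈ 𝒰.covers, StarBelow U a b

/-! ### The completion -/

/-- The relations for the theory of regular Cauchy filters `F`, with the generator `a` standing for
`[a ∈ F]`. -/
inductive CompletionRel (𝒰 : PreUniformity L) : FreeFrame L → FreeFrame L → Prop
  | top : CompletionRel 𝒰 ⊤ (FreeFrame.gen ⊤)
  | inf_le (a b : L) :
      CompletionRel 𝒰 (FreeFrame.gen (a ⊓ b)) (FreeFrame.gen a ⊓ FreeFrame.gen b)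
  | le_inf (a b : L) :
      CompletionRel 𝒰 (FreeFrame.gen a ⊓ FreeFrame.gen b) (FreeFrame.gen (a ⊓ b))
  | proper (a : L) : CompletionRel 𝒰 (FreeFrame.gen a) (⨆ _ : ⊥ < a, ⊤)
  | cauchy (U : Set L) (hU : U ∈ 𝒰.covers) :
      CompletionRel 𝒰 ⊤ (⨆ u ∈ U, FreeFrame.gen u)
  | regular (a : L) :
      CompletionRel 𝒰 (FreeFrame.gen a)
        (⨆ (b : L) (_ : 𝒰.UniformlyBelow b a), FreeFrame.gen b)

/-- The frame of opens of the completion: the locale of regular Cauchy filters. -/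
abbrev Completion (𝒰 : PreUniformity L) : Type u := PresentedFrame (CompletionRel 𝒰)

/-- The open `[a ∈ F]` of the completion. -/
def Completion.mem (𝒰 : PreUniformity L) (a : L) : 𝒰.Completion :=
  PresentedFrame.gen (CompletionRel 𝒰) a

end PreUniformity

/-! ### The locale of modulated Cauchy sequences -/

section Cauchy

variable {L : Type u} [Order.Frame L]

/-- The generators `[s(n) ∈ u]` and `[m(U) = k]`. -/
inductive CauchyGen (B : Set (Set L)) : Type u
  | seq (n : ℕ) (u : L) : CauchyGen B
  | modulus (U : B) (k : ℕ) : CauchyGen B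

/-- The relations for the theory of modulated Cauchy sequences. The first two state the equality
`⋁_α ⋀_{u ∈ F_α} [s(n) ∈ u] = [s(n) ∈ ⋁_α ⋀ F_α]` for every family of finite sets `F_α`. -/
inductive CauchyRel (B : Set (Set L)) :
    FreeFrame (CauchyGen B) → FreeFrame (CauchyGen B) → Prop
  | seq_le (n : ℕ) (𝓕 : Set (Finset L)) :
      CauchyRel B (⨆ S ∈ 𝓕, S.inf fun u => FreeFrame.gen (.seq n u))
        (FreeFrame.gen (.seq n (⨆ S ∈ 𝓕, S.inf id)))
  | le_seq (n : ℕ) (𝓕 : Set (Finset L)) :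
      CauchyRel B (FreeFrame.gen (.seq n (⨆ S ∈ 𝓕, S.inf id)))
        (⨆ S ∈ 𝓕, S.inf fun u => FreeFrame.gen (.seq n u))
  | total (U : B) : CauchyRel B ⊤ (⨆ k : ℕ, FreeFrame.gen (.modulus U k))
  | cauchy (U : B) (k n n' : ℕ) (hn : k ≤ n) (hn' : k ≤ n') :
      CauchyRel B (FreeFrame.gen (.modulus U k))
        (⨆ u ∈ (U : Set L), FreeFrame.gen (.seq n u) ⊓ FreeFrame.gen (.seq n' u))

/-- The frame of opens of the locale of modulated Cauchy sequences, for the base `B`. -/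
abbrev CauchyFrame (B : Set (Set L)) : Type u := PresentedFrame (CauchyRel B)

/-- The open `[s(n) ∈ u]`. -/
def CauchyFrame.seq (B : Set (Set L)) (n : ℕ) (u : L) : CauchyFrame B :=
  PresentedFrame.gen (CauchyRel B) (.seq n u)

/-- The open `[m(U) = k]`. -/
def CauchyFrame.modulus (B : Set (Set L)) (U : B) (k : ℕ) : CauchyFrame B :=
  PresentedFrame.gen (CauchyRel B) (.modulus U k)

/-- The defining equation of (the frame homomorphism `q^*` of) the limit map `q`. -/
def IsLimitMap (𝒰 : PreUniformity L) (B : Set (Set L))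
    (q : FrameHom 𝒰.Completion (CauchyFrame B)) : Prop :=
  ∀ u : L, q (PreUniformity.Completion.mem 𝒰 u) =
    ⨆ (U : B) (v : L) (u' : L) (_ : StarBelow (U : Set L) v u') (_ : 𝒰.UniformlyBelow u' u)
      (k' : ℕ) (k : ℕ) (_ : k' ≤ k), CauchyFrame.modulus B U k' ⊓ CauchyFrame.seq B k v

/-- The defining equation of the suplattice map `q_#`, on the opens
`⋀ i, [s(n i) ∈ u i] ∧ ⋀ j, [m(U j) = k j]` with distinct `n i` and nonzero `u i`. -/
def IsLimitAssignment (𝒰 : PreUniformity L) (B : Set (Set L))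
    (g : sSupHom (CauchyFrame B) 𝒰.Completion) : Prop :=
  ∀ (p r : ℕ) (n : Fin p → ℕ) (u : Fin p → L) (U : Fin r → B) (k : Fin r → ℕ),
    Function.Injective n → (∀ i, ⊥ < u i) →
    g ((⨅ i, CauchyFrame.seq B (n i) (u i)) ⊓ ⨅ j, CauchyFrame.modulus B (U j) (k j)) =
      ⨆ (V : Fin r → B) (_ : ∀ j, Refines (starCover (V j : Set L)) (U j))
        (v : Fin p → L) (_ : ∀ i, v i ∈ ⋃₀ B)
        (_ : ∀ i j, k j ≤ n i → v i ∈ lowerClosure (V j : Set L))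
        (_ : ∀ i, Meets (v i) (u i)),
        ⨅ i, PreUniformity.Completion.mem 𝒰 (v i)

end Cauchy

/-! ### Lower triquotients -/

section Triquotient

variable {L : Type u} {M : Type v} [Order.Frame L] [Order.Frame M]

/-- `g = f_#` is a triquotiency assignment for the locale map with frame homomorphism `f = f^*`. -/
def IsTriquotiencyAssignment (f : FrameHom M L) (g : sSupHom L M) : Prop :=
  g ⊤ = ⊤ ∧ ∀ (a : L) (b : M), g (a ⊓ f b) = g a ⊓ b

/-- The locale map with frame homomorphism `f` is a lower triquotient. -/
def IsLowerTriquotient (f : FrameHom M L) : Prop :=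
  ∃ g : sSupHom L M, IsTriquotiencyAssignment f g

end Triquotient

/-- The locale map `L ⟶ M` given by a frame homomorphism `M → L`. -/
def localeMap {L M : Type u} [Order.Frame L] [Order.Frame M] (f : FrameHom M L) :
    Locale.of L ⟶ Locale.of M :=
  (Frm.ofHom f).op

/-- A pullback-stable quotient of locales: every pullback of the map (in particular the map itself)
is a regular epimorphism in the category of locales. -/
def IsStableQuotient {X Y : Locale.{u}} (f : X ⟶ Y) : Prop :=
  (MorphismProperty.regularEpi Locale.{u}).universally f

/-! ### Suplattice homomorphisms out of quotient frames -/

/-! The limit of a modulated Cauchy sequence lies in `u` once some term past the modulus of `U` lies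
in a `v` with `v ◁_U u' ◁ u`. This yields a regular Cauchy filter because later terms stay in the
star of any open already visited (`modulus_inf_seq_le`) and because `◁` interpolates.

The assignment `q_#` turns finitely many constraints on a sequence into a condition on its limit
filter `F`: there are opens `v_i` in `F`, small enough for the prescribed moduli, in which the
constrained terms can still be placed. To construct it, `exists_sSupHom` extends an antitone
function on finite sets of generators, provided every relation is respected after meeting both sides
with any finite set of generators. Here the relations hold for these reasons: an open meeting a join
meets one of its members; a new term can be placed because `F` is Cauchy; a modulus beyond all
constrained indices imposes nothing; and if `V⋆ ≤ U`, two members of `V` that meet lie in one member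
of `U`.

The Frobenius law (`apply_inf_limitOpen`) holds because finitely many constraints leave later terms
free, so a fresh term with a fresh modulus can record that `u` belongs to `F`.

A triquotiency assignment transports along any base change (`exists_cocone`). Comparing the
transported and original assignments exhibits the map as a coequalizer, and transport makes this
stable under pullback. -/

section StableQuotient

variable {A : Type u} {N : Type v} [Order.Frame A] [Order.Frame N]

/-- The largest preorder contained in `Φ x ≤ Φ y` that is compatible with binary meets. -/
def StableLE (Φ : sSupHom A N) (x y : A) : Prop := ∀ e, Φ (x ⊓ e) ≤ Φ (y ⊓ e)

/-- The largest quotient frame through which the suplattice homomorphism `Φ` factors. -/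
def stableSublocale (Φ : sSupHom A N) : Sublocale A where
  carrier := {x | ∀ y, StableLE Φ y x → y ≤ x}
  sInf_mem' s hs y hy := le_sInf fun x hx => hs hx y fun e =>
    (hy e).trans (OrderHomClass.mono Φ (inf_le_inf_right _ (sInf_le hx)))
  himp_mem' a x hx y hy := by
    rw [le_himp_iff]
    refine hx _ fun e => ?_
    rw [inf_assoc]
    refine (hy _).trans (OrderHomClass.mono Φ ?_)
    rw [← inf_assoc]
    exact inf_le_inf_right _ himp_inf_le

namespace StableQuotient

variable (Φ : sSupHom A N)

theorem restrict_le_iff {x : A} {y : ↥(stableSublocale Φ)} :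
    (stableSublocale Φ).restrict x ≤ y ↔ x ≤ y.1 :=
  (stableSublocale Φ).giRestrict.gc x y

theorem le_restrict (x : A) : x ≤ ((stableSublocale Φ).restrict x).1 :=
  (stableSublocale Φ).giRestrict.gc.le_u_l x

theorem stableLE_restrict (x : A) : StableLE Φ ((stableSublocale Φ).restrict x).1 x := by
  -- The largest element stably below `x` exists because `Φ` and meets preserve joins; it is a point
  -- of the sublocale and therefore bounds the nucleus at `x`.
  let r : A := sSup {y | StableLE Φ y x}
  have hr : StableLE Φ r x := by
    intro e
    simp only [r, sSup_inf_eq, map_iSup]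
    exact iSup₂_le fun y hy => hy e
  have hmem : r ∈ stableSublocale Φ := fun y hy => le_sSup fun e => (hy e).trans (hr e)
  have h1 : (stableSublocale Φ).restrict x ≤ ⟨r, hmem⟩ :=
    (restrict_le_iff Φ).2 (le_sSup fun _ => le_rfl)
  exact fun e => (OrderHomClass.mono Φ (inf_le_inf_right _ (show _ ≤ r from h1))).trans (hr e)

theorem restrict_le_restrict_iff {x y : A} :
    (stableSublocale Φ).restrict x ≤ (stableSublocale Φ).restrict y ↔ StableLE Φ x y := by
  rw [restrict_le_iff]
  constructor
  · exact fun h e => (OrderHomClass.mono Φ (inf_le_inf_right _ h)).trans (stableLE_restrict Φ y e)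
  · exact fun h => ((stableSublocale Φ).restrict y).2 x fun e =>
      (h e).trans (OrderHomClass.mono Φ (inf_le_inf_right _ (le_restrict Φ y)))

theorem apply_restrict (x : A) : Φ ((stableSublocale Φ).restrict x : A) = Φ x := by
  apply le_antisymm
  · simpa using stableLE_restrict Φ x ⊤
  · exact OrderHomClass.mono Φ (le_restrict Φ x)

theorem restrict_val (x : ↥(stableSublocale Φ)) : (stableSublocale Φ).restrict x.1 = x :=
  (stableSublocale Φ).giRestrict.l_u_eq x

/-- The factorization of `Φ` through its largest quotient frame. -/
def desc : sSupHom ↥(stableSublocale Φ) N where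
  toFun x := Φ x.1
  map_sSup' s := by
    have hs : sSup s = (stableSublocale Φ).restrict (sSup (Subtype.val '' s)) := by
      rw [map_sSup, Set.image_image]
      simp only [restrict_val, Set.image_id']
    rw [hs, apply_restrict, map_sSup, Set.image_image]

theorem desc_restrict (x : A) : desc Φ ((stableSublocale Φ).restrict x) = Φ x :=
  apply_restrict Φ x

end StableQuotient

end StableQuotient

/-! ### Suplattice homomorphisms out of lower sets -/

section LowerSetExtend

variable {P : Type u} [Preorder P] {N : Type v} [CompleteLattice N]

/-- The suplattice homomorphism on lower sets determined by a function on the elements. -/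
def lowerSetExtend (φ : P → N) : sSupHom (LowerSet P) N where
  toFun a := ⨆ p ∈ a, φ p
  map_sSup' s := by
    apply le_antisymm
    · refine iSup₂_le fun p hp => ?_
      obtain ⟨a, ha, hpa⟩ := LowerSet.mem_sSup_iff.1 hp
      exact (le_iSup₂ (f := fun p (_ : p ∈ a) => φ p) p hpa).trans
        (le_sSup (Set.mem_image_of_mem _ ha))
    · refine sSup_le ?_
      rintro _ ⟨a, ha, rfl⟩
      exact iSup₂_le fun p hp => le_iSup₂_of_le p (LowerSet.mem_sSup_iff.2 ⟨a, ha, hp⟩) le_rfl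

theorem lowerSetExtend_Iic {φ : P → N} (hφ : Monotone φ) (p : P) :
    lowerSetExtend φ (LowerSet.Iic p) = φ p :=
  le_antisymm (iSup₂_le fun _ hq => hφ (LowerSet.mem_Iic_iff.1 hq))
    (le_iSup₂_of_le p (LowerSet.mem_Iic_iff.2 le_rfl) le_rfl)

theorem LowerSet.eq_iSup_Iic (a : LowerSet P) : a = ⨆ p ∈ a, LowerSet.Iic p := by
  apply le_antisymm
  · intro p hp
    exact (le_iSup₂ (f := fun p (_ : p ∈ a) => LowerSet.Iic p) p hp)
      (LowerSet.mem_Iic_iff.2 le_rfl)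
  · exact iSup₂_le fun p hp => LowerSet.Iic_le.2 hp

end LowerSetExtend

/-- Every lower set is a join of principal ones and both sides preserve joins, so principal test
elements suffice. -/
theorem stableLE_lowerSetExtend {P : Type u} [Preorder P] {N : Type v} [Order.Frame N]
    {φ : P → N} {x y : LowerSet P}
    (h : ∀ p, lowerSetExtend φ (x ⊓ LowerSet.Iic p) ≤ lowerSetExtend φ (y ⊓ LowerSet.Iic p)) :
    StableLE (lowerSetExtend φ) x y := by
  intro e
  rw [LowerSet.eq_iSup_Iic e]
  simp only [inf_iSup_eq, map_iSup]
  exact iSup₂_mono fun p _ => h p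

/-! ### Suplattice homomorphisms out of presented frames -/

namespace FreeFrame

variable {G : Type u}

theorem finset_inf_gen (S : Finset G) : S.inf gen = LowerSet.Iic (OrderDual.toDual S) := by
  ext T
  have h1 : T ∈ S.inf gen ↔ LowerSet.Iic T ≤ S.inf gen := LowerSet.Iic_le.symm
  change T ∈ S.inf gen ↔ T ∈ LowerSet.Iic (OrderDual.toDual S)
  rw [h1, Finset.le_inf_iff, LowerSet.mem_Iic_iff]
  simp only [LowerSet.Iic_le, mem_gen]
  exact ⟨fun h x hx => h x hx, fun h x hx => h hx⟩

open Classical in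
theorem Iic_inf_finset_inf (S T : Finset G) :
    T.inf gen ⊓ LowerSet.Iic (OrderDual.toDual S) = LowerSet.Iic (OrderDual.toDual (S ∪ T)) := by
  rw [← finset_inf_gen, ← finset_inf_gen, Finset.inf_union, inf_comm]

end FreeFrame

namespace PresentedFrame

variable {G : Type u} {R : FreeFrame G → FreeFrame G → Prop}

/-- By `hR` the relations hold in the largest quotient frame of the free frame through which the
extension of `φ` factors. The universal property then gives a frame homomorphism into that quotient,
to be followed by the factored suplattice map. -/
theorem exists_sSupHom {M : Type v} [Order.Frame M] (φ : Finset G → M) (hφ : Antitone φ)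
    (hR : ∀ a b, R a b → ∀ S : Finset G,
      lowerSetExtend (φ ∘ OrderDual.ofDual) (a ⊓ LowerSet.Iic (OrderDual.toDual S)) ≤
        lowerSetExtend (φ ∘ OrderDual.ofDual) (b ⊓ LowerSet.Iic (OrderDual.toDual S))) :
    ∃ g : sSupHom (PresentedFrame R) M, ∀ S : Finset G, g (S.inf (gen R)) = φ S := by
  let Φ : sSupHom (FreeFrame G) M := lowerSetExtend (φ ∘ OrderDual.ofDual)
  let π := (stableSublocale Φ).restrict
  have hπ : FreeFrame.lift (fun g => π (FreeFrame.gen g)) = π :=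
    FreeFrame.hom_ext fun g => FreeFrame.lift_gen _ g
  obtain ⟨h, hh, -⟩ := existsUnique_lift (R := R) (fun g => π (FreeFrame.gen g)) fun a b hab => by
    rw [hπ]
    exact (StableQuotient.restrict_le_restrict_iff Φ).2
      (stableLE_lowerSetExtend fun S => hR a b hab (OrderDual.ofDual S))
  refine ⟨(StableQuotient.desc Φ).comp ⟨h, fun s => map_sSup h s⟩, fun S => ?_⟩
  have h1 : h (S.inf (gen R)) = π (LowerSet.Iic (OrderDual.toDual S)) := by
    rw [← FreeFrame.finset_inf_gen, map_finset_inf, map_finset_inf]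
    exact congrArg S.inf (funext hh)
  change StableQuotient.desc Φ (h (S.inf (gen R))) = φ S
  rw [h1]
  exact (StableQuotient.desc_restrict Φ _).trans
    (lowerSetExtend_Iic (φ := φ ∘ OrderDual.ofDual) (fun _ _ hST => hφ hST) _)

/-- Every element of a presented frame is a join of finite meets of generators. -/
theorem eq_iSup (x : PresentedFrame R) :
    ∃ a : FreeFrame G, x = ⨆ S ∈ a, (OrderDual.ofDual S).inf (gen R) := by
  obtain ⟨a, rfl⟩ := mk_surjective x
  refine ⟨a, ?_⟩
  conv_lhs => rw [FreeFrame.eq_iSup a]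
  simp only [map_iSup, map_finset_inf]
  rfl

end PresentedFrame

/-! ### Pullback-stability of lower triquotients -/

section Triquotient

theorem IsTriquotiencyAssignment.apply_map {L : Type u} {M : Type v} [Order.Frame L]
    [Order.Frame M] {f : FrameHom M L} {g : sSupHom L M} (h : IsTriquotiencyAssignment f g)
    (b : M) : g (f b) = b := by
  simpa [h.1] using h.2 ⊤ b

variable {L M N : Type u} [Order.Frame L] [Order.Frame M] [Order.Frame N]

/-- A cocone under `f` and `k` on which the base change of the triquotiency assignment `g` lives. -/
theorem IsTriquotiencyAssignment.exists_cocone {f : FrameHom M L} {g : sSupHom L M}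
    (hg : IsTriquotiencyAssignment f g) (k : FrameHom M N) :
    ∃ (P : Type u) (_ : Order.Frame P) (i : FrameHom L P) (j : FrameHom N P) (h : sSupHom P N),
      (∀ m, i (f m) = j (k m)) ∧ (∀ a, h (i a) = k (g a)) ∧ IsTriquotiencyAssignment j h := by
  -- This is the value that Beck–Chevalley and Frobenius force on `i a ⊓ j n`. The quotient it
  -- induces on lower sets of `L × N` need not be the pushout; a cocone carrying the assignment is
  -- enough.
  let φ : L × N → N := fun p => k (g p.1) ⊓ p.2
  have hφ : Monotone φ := fun p q hpq =>
    inf_le_inf (OrderHomClass.mono k (OrderHomClass.mono g hpq.1)) hpq.2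
  let Φ := lowerSetExtend φ
  let π := (stableSublocale Φ).restrict
  have hI : ∀ p q : L × N, Φ (LowerSet.Iic p ⊓ LowerSet.Iic q) =
      k (g (p.1 ⊓ q.1)) ⊓ (p.2 ⊓ q.2) := by
    intro p q
    rw [← LowerSet.Iic_inf]
    exact lowerSetExtend_Iic hφ _
  have hle : ∀ x y : LowerSet (L × N), (∀ p, Φ (x ⊓ LowerSet.Iic p) ≤ Φ (y ⊓ LowerSet.Iic p)) →
      π x ≤ π y := fun x y h =>
    (StableQuotient.restrict_le_restrict_iff Φ).2 (stableLE_lowerSetExtend h)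
  have hmono : ∀ p q : L × N, p ≤ q → π (LowerSet.Iic p) ≤ π (LowerSet.Iic q) := fun p q h =>
    OrderHomClass.mono π (LowerSet.Iic_le.2 h)
  let i : FrameHom L ↥(stableSublocale Φ) :=
    { toFun := fun a => π (LowerSet.Iic (a, ⊤))
      map_inf' := fun a b => by
        rw [← map_inf, ← LowerSet.Iic_inf]
        simp
      map_top' := by
        rw [← map_top π, ← LowerSet.Iic_top]
        rfl
      map_sSup' := fun s => by
        apply le_antisymm
        · rw [sSup_image]
          simp only [← map_iSup]
          refine hle _ _ fun p => ?_
          simp only [iSup_inf_eq, map_iSup, hI, top_inf_eq, sSup_inf_eq]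
          exact le_rfl
        · refine sSup_le ?_
          rintro _ ⟨a, ha, rfl⟩
          exact hmono _ _ ⟨le_sSup ha, le_rfl⟩ }
  let j : FrameHom N ↥(stableSublocale Φ) :=
    { toFun := fun n => π (LowerSet.Iic (⊤, n))
      map_inf' := fun a b => by
        rw [← map_inf, ← LowerSet.Iic_inf]
        simp
      map_top' := by
        rw [← map_top π, ← LowerSet.Iic_top]
        rfl
      map_sSup' := fun s => by
        apply le_antisymm
        · rw [sSup_image]
          simp only [← map_iSup]
          refine hle _ _ fun p => ?_
          simp only [iSup_inf_eq, map_iSup, hI, top_inf_eq, sSup_inf_eq, inf_iSup_eq]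
          exact le_rfl
        · refine sSup_le ?_
          rintro _ ⟨a, ha, rfl⟩
          exact hmono _ _ ⟨le_rfl, le_sSup ha⟩ }
  refine ⟨↥(stableSublocale Φ), inferInstance, i, j, StableQuotient.desc Φ, ?_, ?_, ?_, ?_⟩
  -- Commutativity of the square is the Frobenius law of `g`: moving `f m` out of `g` turns it into
  -- the factor `k m`.
  · intro m
    apply le_antisymm
    · refine hle _ _ fun p => ?_
      rw [hI, hI]
      simp only [top_inf_eq]
      rw [inf_comm (f m), hg.2, map_inf, inf_assoc, inf_comm (k m)]
    · refine hle _ _ fun p => ?_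
      rw [hI, hI]
      simp only [top_inf_eq]
      rw [inf_comm (f m), hg.2, map_inf, inf_assoc, inf_comm (k m)]
  · intro a
    refine (StableQuotient.desc_restrict Φ _).trans ((lowerSetExtend_Iic hφ _).trans ?_)
    simp [φ]
  · rw [← map_top j]
    refine (StableQuotient.desc_restrict Φ _).trans ((lowerSetExtend_Iic hφ _).trans ?_)
    simp [φ, hg.1]
  · intro x n
    -- Frobenius is checked on principal lower sets, of which every element is a join.
    rw [← StableQuotient.restrict_val Φ x]
    change StableQuotient.desc Φ (π _ ⊓ π _) = _
    rw [← map_inf, StableQuotient.desc_restrict, StableQuotient.desc_restrict,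
      LowerSet.eq_iSup_Iic x.1]
    simp only [iSup_inf_eq, map_iSup]
    refine iSup_congr fun p => iSup_congr fun _ => ?_
    rw [hI, lowerSetExtend_Iic hφ]
    simp [φ, inf_assoc]

/-- A lower triquotient is the equalizer of its cocone. -/
theorem IsTriquotiencyAssignment.isRegularEpi {f : FrameHom M L} {g : sSupHom L M}
    (hg : IsTriquotiencyAssignment f g) : IsRegularEpi (localeMap f) := by
  obtain ⟨P, _, i, j, h, hij, hi, hj⟩ := hg.exists_cocone f
  have hinj : Function.Injective f := fun a b hab => by
    rw [← hg.apply_map a, hab, hg.apply_map]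
  -- Applying `h` to `i a = j a` gives `f (g a)` on one side and `a` on the other, so the equalizer
  -- of `i` and `j` is exactly the image of `f`.
  have hfix : ∀ a, i a = j a → f (g a) = a := fun a ha => by
    rw [← hi, ha, hj.apply_map]
  have w : localeMap i ≫ localeMap f = localeMap j ≫ localeMap f := by
    apply Quiver.Hom.unop_inj
    ext m
    exact hij m
  refine ⟨⟨⟨Locale.of P, localeMap i, localeMap j, w,
    Limits.Cofork.IsColimit.mk' _ fun s => ?_⟩⟩⟩
  let p : FrameHom s.pt.unop L := s.π.unop.hom
  have hp : ∀ x, i (p x) = j (p x) := fun x =>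
    congrArg (fun t : Locale.of P ⟶ s.pt => t.unop.hom x) s.condition
  have hgp : ∀ x, f (g (p x)) = p x := fun x => hfix _ (hp x)
  let l : FrameHom s.pt.unop M :=
    { toFun := fun x => g (p x)
      map_inf' := fun x y => hinj (by rw [hgp, map_inf, map_inf, hgp, hgp])
      map_top' := hinj (by simp only [map_top, hg.1])
      map_sSup' := fun t => hinj (by
        rw [hgp, map_sSup, map_sSup, Set.image_image]
        simp only [hgp]) }
  refine ⟨(Frm.ofHom l).op, ?_, ?_⟩
  · apply Quiver.Hom.unop_inj
    ext x
    exact hgp x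
  · intro m hm
    apply Quiver.Hom.unop_inj
    ext x
    apply hinj
    exact (congrArg (fun t : Locale.of L ⟶ s.pt => t.unop.hom x) hm).trans (hgp x).symm

/-- The pullback need not be computed: the cocone factors through it, and composing with the
comparison map gives a triquotiency assignment for the pulled-back map. -/
theorem IsTriquotiencyAssignment.isStableQuotient {f : FrameHom M L} {g : sSupHom L M}
    (hg : IsTriquotiencyAssignment f g) : IsStableQuotient (localeMap f) := by
  intro X' Y' i₁ i₂ f' H
  obtain ⟨P, _, i, j, h, hij, -, hj⟩ := hg.exists_cocone (N := Y'.unop) i₂.unop.hom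
  have w : localeMap j ≫ i₂ = localeMap i ≫ localeMap f := by
    apply Quiver.Hom.unop_inj
    ext m
    exact (hij m).symm
  let c : FrameHom X'.unop P := (H.lift (localeMap j) (localeMap i) w).unop.hom
  have hc : ∀ y, c (f'.unop.hom y) = j y := fun y =>
    congrArg (fun t : Locale.of P ⟶ Y' => t.unop.hom y) (H.lift_fst (localeMap j) (localeMap i) w)
  have hf' : IsTriquotiencyAssignment f'.unop.hom (h.comp ⟨c, fun s => map_sSup c s⟩) := by
    refine ⟨?_, fun a b => ?_⟩
    · change h (c ⊤) = ⊤
      rw [map_top, hj.1]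
    · change h (c (a ⊓ _)) = h (c a) ⊓ b
      rw [map_inf, hc, hj.2]
  exact hf'.isRegularEpi

end Triquotient

/-! ### Stars and the uniformly below relation -/

section Covers

variable {L : Type u} [Order.Frame L]

theorem Meets.symm {a b : L} (h : Meets a b) : Meets b a := by
  rwa [Meets, inf_comm]

theorem Meets.mono {a b a' b' : L} (h : Meets a b) (ha : a ≤ a') (hb : b ≤ b') : Meets a' b' :=
  lt_of_lt_of_le h (inf_le_inf ha hb)

theorem meets_self {a : L} (h : ⊥ < a) : Meets a a := by
  rwa [Meets, inf_idem]

theorem not_meets {a b : L} : ¬ Meets a b ↔ a ⊓ b = ⊥ := by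
  rw [Meets, bot_lt_iff_ne_bot, not_not]

theorem meets_sSup {a : L} {s : Set L} : Meets a (sSup s) ↔ ∃ b ∈ s, Meets a b := by
  simp only [Meets, bot_lt_iff_ne_bot, inf_sSup_eq, ne_eq, iSup_eq_bot, not_forall, exists_prop]

theorem le_starOf {a x : L} {U : Set L} (hx : x ∈ U) (h : Meets a x) : x ≤ starOf a U :=
  le_sSup ⟨hx, h⟩

theorem starOf_mono {a a' : L} (h : a ≤ a') (U : Set L) : starOf a U ≤ starOf a' U :=
  sSup_le fun _ hx => le_starOf hx.1 (hx.2.mono h le_rfl)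

theorem starOf_le_of_refines {U V : Set L} (h : Refines U V) (a : L) :
    starOf a U ≤ starOf a V :=
  sSup_le fun x hx => by
    obtain ⟨y, hy, hxy⟩ := h x hx.1
    exact hxy.trans (le_starOf hy (hx.2.mono le_rfl hxy))

theorem Refines.trans {U V W : Set L} (h : Refines U V) (h' : Refines V W) : Refines U W :=
  fun u hu => by
    obtain ⟨v, hv, huv⟩ := h u hu
    obtain ⟨w, hw, hvw⟩ := h' v hv
    exact ⟨w, hw, huv.trans hvw⟩

theorem Refines.starCover {U V : Set L} (h : Refines U V) :
    Refines (starCover U) (starCover V) := by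
  rintro _ ⟨u, hu, rfl⟩
  obtain ⟨v, hv, huv⟩ := h u hu
  exact ⟨starOf v V, ⟨v, hv, rfl⟩, (starOf_mono huv U).trans (starOf_le_of_refines h v)⟩

theorem IsStrongCover.le_starOf {U : Set L} (hU : IsStrongCover U) (a : L) : a ≤ starOf a U := by
  have ha : a = ⨆ x ∈ U, a ⊓ x := by rw [← inf_sSup_eq, hU.1, inf_top_eq]
  conv_lhs => rw [ha]
  refine iSup₂_le fun x hx => ?_
  by_cases h : Meets a x
  · exact inf_le_right.trans (_root_.le_starOf hx h)
  · rw [not_meets.1 h]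
    exact bot_le

theorem IsStrongCover.le_of_starBelow {U : Set L} (hU : IsStrongCover U) {a b : L}
    (h : StarBelow U a b) : a ≤ b :=
  (hU.le_starOf a).trans h

theorem StarBelow.mono {U : Set L} {a a' b b' : L} (h : StarBelow U a b) (ha : a' ≤ a)
    (hb : b ≤ b') : StarBelow U a' b' :=
  (starOf_mono ha U).trans (h.trans hb)

theorem StarBelow.refines {U V : Set L} {a b : L} (h : StarBelow U a b) (hV : Refines V U) :
    StarBelow V a b :=
  (starOf_le_of_refines hV a).trans h

theorem StarBelow.inf {U : Set L} {a b a' b' : L} (h : StarBelow U a b)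
    (h' : StarBelow U a' b') : StarBelow U (a ⊓ a') (b ⊓ b') :=
  le_inf (h.mono inf_le_left le_rfl) (h'.mono inf_le_right le_rfl)

/-- If `V⋆ ≤ U`, members of `V` that meet lie below a common member of `U`. -/
theorem exists_le_of_meets {U V : Set L} (h : Refines (starCover V) U) {p : L} (hp : p ∈ V) :
    ∃ x ∈ U, ∀ p' ∈ V, Meets p p' → p' ≤ x := by
  obtain ⟨x, hx, hpx⟩ := h _ ⟨p, hp, rfl⟩
  exact ⟨x, hx, fun p' hp' hpp' => (le_starOf hp' hpp').trans hpx⟩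

/-- A member of `V` meeting the first star meets some `p'` in `V` that meets `a`; both lie in one
member of `U`, which then meets `a`. -/
theorem starOf_starOf_le {U V : Set L} (hV : IsStrongCover V) (h : Refines (starCover V) U)
    (a : L) : starOf (starOf a V) V ≤ starOf a U := by
  refine sSup_le ?_
  rintro p ⟨hp, hap⟩
  obtain ⟨p', ⟨hp', hap'⟩, hpp'⟩ := meets_sSup.1 hap.symm
  obtain ⟨x, hx, H⟩ := exists_le_of_meets h hp'
  exact (H p hp hpp'.symm).trans
    (le_starOf hx (hap'.mono le_rfl (H p' hp' (meets_self (hV.2 p' hp')))))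

end Covers

namespace PreUniformity

variable {L : Type u} [Order.Frame L] {𝒰 : PreUniformity L}

theorem UniformlyBelow.le {a b : L} (h : 𝒰.UniformlyBelow a b) : a ≤ b := by
  obtain ⟨U, hU, hab⟩ := h
  exact (𝒰.isStrongCover U hU).le_of_starBelow hab

theorem UniformlyBelow.mono {a a' b b' : L} (h : 𝒰.UniformlyBelow a b) (ha : a' ≤ a)
    (hb : b ≤ b') : 𝒰.UniformlyBelow a' b' := by
  obtain ⟨U, hU, hab⟩ := h
  exact ⟨U, hU, hab.mono ha hb⟩

theorem UniformlyBelow.inf {a b a' b' : L} (h : 𝒰.UniformlyBelow a b)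
    (h' : 𝒰.UniformlyBelow a' b') : 𝒰.UniformlyBelow (a ⊓ a') (b ⊓ b') := by
  obtain ⟨U, hU, hab⟩ := h
  obtain ⟨U', hU', hab'⟩ := h'
  obtain ⟨W, hW, hWU, hWU'⟩ := 𝒰.directed U hU U' hU'
  exact ⟨W, hW, (hab.refines hWU).inf (hab'.refines hWU')⟩

theorem uniformlyBelow_top (a : L) : 𝒰.UniformlyBelow a ⊤ := by
  obtain ⟨U, hU⟩ := 𝒰.nonempty
  exact ⟨U, hU, le_top⟩

theorem UniformlyBelow.interpolate {a b : L} (h : 𝒰.UniformlyBelow a b) :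
    ∃ c, 𝒰.UniformlyBelow a c ∧ 𝒰.UniformlyBelow c b := by
  obtain ⟨U, hU, hab⟩ := h
  obtain ⟨V, hV, hVU⟩ := 𝒰.exists_star_refines U hU
  exact ⟨starOf a V, ⟨V, hV, le_rfl⟩, V, hV,
    (starOf_starOf_le (𝒰.isStrongCover V hV) hVU a).trans hab⟩

variable {B : Set (Set L)}

theorem IsBase.isStrongCover (hB : 𝒰.IsBase B) {U : Set L} (hU : U ∈ B) : IsStrongCover U :=
  𝒰.isStrongCover U (hB.1 hU)

theorem IsBase.exists_mem (hB : 𝒰.IsBase B) : ∃ U, U ∈ B := by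
  obtain ⟨U, hU⟩ := 𝒰.nonempty
  obtain ⟨V, hV, -⟩ := hB.2 U hU
  exact ⟨V, hV⟩

theorem IsBase.directed (hB : 𝒰.IsBase B) {U V : Set L} (hU : U ∈ B) (hV : V ∈ B) :
    ∃ W ∈ B, Refines W U ∧ Refines W V := by
  obtain ⟨W, hW, h1, h2⟩ := 𝒰.directed U (hB.1 hU) V (hB.1 hV)
  obtain ⟨W', hW', h⟩ := hB.2 W hW
  exact ⟨W', hW', h.trans h1, h.trans h2⟩

theorem IsBase.exists_star_refines (hB : 𝒰.IsBase B) {U : Set L} (hU : U ∈ 𝒰.covers) :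
    ∃ V ∈ B, Refines (starCover V) U := by
  obtain ⟨W, hW, h⟩ := 𝒰.exists_star_refines U hU
  obtain ⟨V, hV, h'⟩ := hB.2 W hW
  exact ⟨V, hV, h'.starCover.trans h⟩

theorem IsBase.exists_starBelow (hB : 𝒰.IsBase B) {a b : L} (h : 𝒰.UniformlyBelow a b) :
    ∃ U ∈ B, StarBelow U a b := by
  obtain ⟨U, hU, hab⟩ := h
  obtain ⟨V, hV, h'⟩ := hB.2 U hU
  exact ⟨V, hV, hab.refines h'⟩

end PreUniformity

/-! ### Relations in the frame of modulated Cauchy sequences -/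

namespace CauchyFrame

variable {L : Type u} [Order.Frame L] {B : Set (Set L)}

theorem seq_iSup_inf (n : ℕ) (𝓕 : Set (Finset L)) :
    seq B n (⨆ S ∈ 𝓕, S.inf id) = ⨆ S ∈ 𝓕, S.inf (seq B n) := by
  have h : PresentedFrame.mk (CauchyRel B)
      (⨆ S ∈ 𝓕, S.inf fun u => FreeFrame.gen (.seq n u)) = ⨆ S ∈ 𝓕, S.inf (seq B n) := by
    simp only [map_iSup, map_finset_inf]
    rfl
  rw [← h]
  exact le_antisymm (PresentedFrame.mk_le_mk (.le_seq n 𝓕))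
    (PresentedFrame.mk_le_mk (.seq_le n 𝓕))

theorem seq_finset_inf (n : ℕ) (S : Finset L) : seq B n (S.inf id) = S.inf (seq B n) := by
  simpa using seq_iSup_inf (B := B) n {S}

theorem seq_top (n : ℕ) : seq B n ⊤ = ⊤ := by
  simpa using seq_finset_inf (B := B) n ∅

theorem seq_bot (n : ℕ) : seq B n ⊥ = ⊥ := by
  simpa using seq_iSup_inf (B := B) n ∅

open Classical in
theorem seq_inf (n : ℕ) (u v : L) : seq B n (u ⊓ v) = seq B n u ⊓ seq B n v := by
  simpa using seq_finset_inf (B := B) n {u, v}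

theorem seq_mono (n : ℕ) : Monotone (seq B n) := fun u v h => by
  rw [← inf_eq_left.2 h, seq_inf]
  exact inf_le_right

theorem iSup_modulus (U : B) : ⨆ k, modulus B U k = ⊤ := by
  have := PresentedFrame.mk_le_mk (CauchyRel.total U)
  rw [map_top, map_iSup] at this
  exact top_le_iff.1 this

theorem modulus_le (U : B) {k n n' : ℕ} (hn : k ≤ n) (hn' : k ≤ n') :
    modulus B U k ≤ ⨆ u ∈ (U : Set L), seq B n u ⊓ seq B n' u := by
  have := PresentedFrame.mk_le_mk (CauchyRel.cauchy U k n n' hn hn')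
  simp only [map_iSup, map_inf] at this
  exact this

/-- Past the modulus of `U`, terms of the sequence stay in the star of any open that is met. -/
theorem modulus_inf_seq_le (U : B) {k n n' : ℕ} (hn : k ≤ n) (hn' : k ≤ n') {v u : L}
    (h : StarBelow (U : Set L) v u) : modulus B U k ⊓ seq B n v ≤ seq B n' u := by
  refine (inf_le_inf_right _ (modulus_le U hn hn')).trans ?_
  simp only [iSup_inf_eq]
  refine iSup₂_le fun x hx => ?_
  by_cases hv : Meets v x
  · exact inf_le_left.trans (inf_le_right.trans (seq_mono _ ((le_starOf hx hv).trans h)))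
  · rw [inf_right_comm, ← seq_inf, inf_comm x, not_meets.1 hv, seq_bot, bot_inf_eq]
    exact bot_le

end CauchyFrame

/-! ### The limit map -/

section LimitMap

open CauchyFrame

variable {L : Type u} [Order.Frame L] (𝒰 : PreUniformity L) (B : Set (Set L))

/-- The open of modulated Cauchy sequences whose limit belongs to `u`. -/
noncomputable def limitOpen (u : L) : CauchyFrame B :=
  ⨆ (U : B) (v : L) (u' : L) (_ : StarBelow (U : Set L) v u') (_ : 𝒰.UniformlyBelow u' u)
    (k' : ℕ) (k : ℕ) (_ : k' ≤ k), modulus B U k' ⊓ seq B k v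

variable {𝒰 B}

theorem le_limitOpen {u : L} (U : B) {v u' : L} (h : StarBelow (U : Set L) v u')
    (h' : 𝒰.UniformlyBelow u' u) {k' k : ℕ} (hk : k' ≤ k) :
    modulus B U k' ⊓ seq B k v ≤ limitOpen 𝒰 B u :=
  le_iSup_of_le U <| le_iSup_of_le v <| le_iSup_of_le u' <| le_iSup_of_le h <|
    le_iSup_of_le h' <| le_iSup_of_le k' <| le_iSup_of_le k <| le_iSup_of_le hk le_rfl

theorem limitOpen_le {u : L} {x : CauchyFrame B}
    (H : ∀ (U : B) (v u' : L), StarBelow (U : Set L) v u' → 𝒰.UniformlyBelow u' u →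
      ∀ k' k : ℕ, k' ≤ k → modulus B U k' ⊓ seq B k v ≤ x) : limitOpen 𝒰 B u ≤ x :=
  iSup_le fun U => iSup_le fun v => iSup_le fun u' => iSup_le fun h => iSup_le fun h' =>
    iSup_le fun k' => iSup_le fun k => iSup_le fun hk => H U v u' h h' k' k hk

theorem limitOpen_mono : Monotone (limitOpen 𝒰 B) := fun _ _ hab =>
  limitOpen_le fun U _ _ h h' _ _ hk => le_limitOpen U h (h'.mono le_rfl hab) hk

theorem limitOpen_top (hB : 𝒰.IsBase B) : limitOpen 𝒰 B ⊤ = ⊤ := by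
  obtain ⟨U, hU⟩ := hB.exists_mem
  rw [← top_le_iff, ← iSup_modulus ⟨U, hU⟩]
  refine iSup_le fun k => ?_
  rw [← inf_top_eq (modulus B _ k), ← seq_top k]
  exact le_limitOpen ⟨U, hU⟩ (u' := ⊤) le_top (𝒰.uniformlyBelow_top ⊤) le_rfl

theorem limitOpen_bot (hB : 𝒰.IsBase B) : limitOpen 𝒰 B ⊥ = ⊥ := by
  refine le_bot_iff.1 (limitOpen_le fun U v u' h h' k' k hk => ?_)
  have : v = ⊥ := le_bot_iff.1 (((hB.isStrongCover U.2).le_of_starBelow h).trans h'.le)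
  rw [this, seq_bot, inf_bot_eq]

theorem inf_limitOpen_le (hB : 𝒰.IsBase B) (a b : L) :
    limitOpen 𝒰 B a ⊓ limitOpen 𝒰 B b ≤ limitOpen 𝒰 B (a ⊓ b) := by
  rw [← le_himp_iff]
  refine limitOpen_le fun U v u' h h' k' k hk => ?_
  rw [le_himp_iff, inf_comm, ← le_himp_iff]
  refine limitOpen_le fun V w w' g g' l' l hl => ?_
  rw [le_himp_iff]
  obtain ⟨y, hy, hya⟩ := h'.interpolate
  obtain ⟨z, hz, hzb⟩ := g'.interpolate
  obtain ⟨W, hW, hWb⟩ := hB.exists_starBelow (hy.inf hz)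
  -- Splitting on the modulus `j` of `W` provides an index `n` past all three moduli, where the term
  -- lies in both `u'` and `w'`.
  rw [← top_inf_eq (_ ⊓ _), ← iSup_modulus ⟨W, hW⟩, iSup_inf_eq]
  refine iSup_le fun j => ?_
  let n := max j (max k l)
  have hjn : j ≤ n := le_max_left _ _
  have hkn : k ≤ n := (le_max_left _ _).trans (le_max_right _ _)
  have hln : l ≤ n := (le_max_right _ _).trans (le_max_right _ _)
  refine le_trans ?_ (le_limitOpen ⟨W, hW⟩ hWb (hya.inf hzb) hjn)
  refine inf_le_inf_left _ ?_
  rw [seq_inf, inf_comm]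
  exact inf_le_inf (modulus_inf_seq_le U hk (hk.trans hkn) h)
    (modulus_inf_seq_le V hl (hl.trans hln) g)

theorem iSup_limitOpen (hB : 𝒰.IsBase B) {U : Set L} (hU : U ∈ 𝒰.covers) :
    ⨆ u ∈ U, limitOpen 𝒰 B u = ⊤ := by
  -- Two star-refinements are needed, since the formula for the limit asks for two successive
  -- enlargements of `v` inside `u`.
  obtain ⟨V', hV', hVU⟩ := 𝒰.exists_star_refines U hU
  obtain ⟨V, hV, hVV⟩ := hB.exists_star_refines hV'
  rw [← top_le_iff, ← iSup_modulus ⟨V, hV⟩]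
  refine iSup_le fun k => ?_
  -- One copy of the modulus is spent on locating `s(k)` in a member of `V`; the other is kept for
  -- the limit formula.
  rw [← inf_idem (modulus B _ k)]
  refine (inf_le_inf_left _ (modulus_le ⟨V, hV⟩ le_rfl le_rfl)).trans ?_
  simp only [inf_iSup_eq, inf_idem]
  refine iSup₂_le fun v hv => ?_
  obtain ⟨v', hv', hvv⟩ := hVV _ ⟨v, hv, rfl⟩
  obtain ⟨u, hu, huv⟩ := hVU _ ⟨v', hv', rfl⟩
  refine le_iSup₂_of_le u hu (le_limitOpen ⟨V, hV⟩ (u' := starOf v V) le_rfl ?_ le_rfl)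
  refine ⟨V, hB.1 hV, ?_⟩
  refine (starOf_starOf_le (hB.isStrongCover hV) hVV v).trans (le_trans ?_ huv)
  exact starOf_mono (((hB.isStrongCover hV).le_starOf v).trans hvv) V'

theorem limitOpen_le_iSup (u : L) :
    limitOpen 𝒰 B u ≤ ⨆ (b : L) (_ : 𝒰.UniformlyBelow b u), limitOpen 𝒰 B b :=
  limitOpen_le fun U _ _ h h' _ _ hk => by
    obtain ⟨b, hb, hbu⟩ := h'.interpolate
    exact le_iSup₂_of_le b hbu (le_limitOpen U h hb hk)

theorem existsUnique_isLimitMap (hB : 𝒰.IsBase B) :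
    ∃! q : FrameHom 𝒰.Completion (CauchyFrame B), IsLimitMap 𝒰 B q := by
  refine PresentedFrame.existsUnique_lift (limitOpen 𝒰 B) fun a b hab => ?_
  cases hab with
  | top => simp [limitOpen_top hB]
  | inf_le a b =>
    simpa using ⟨limitOpen_mono inf_le_left, limitOpen_mono inf_le_right⟩
  | le_inf a b => simpa using inf_limitOpen_le hB a b
  | proper a =>
    rcases eq_or_ne a ⊥ with rfl | ha
    · simp [limitOpen_bot hB]
    · simp [bot_lt_iff_ne_bot.2 ha]
  | cauchy U hU => simp [iSup_limitOpen hB hU]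
  | regular a => simpa using limitOpen_le_iSup a

end LimitMap

/-! ### The completion -/

namespace PreUniformity.Completion

variable {L : Type u} [Order.Frame L] (𝒰 : PreUniformity L)

theorem mem_top : mem 𝒰 ⊤ = ⊤ := by
  have := PresentedFrame.mk_le_mk (CompletionRel.top (𝒰 := 𝒰))
  rw [map_top] at this
  exact top_le_iff.1 this

theorem mem_inf (a b : L) : mem 𝒰 (a ⊓ b) = mem 𝒰 a ⊓ mem 𝒰 b := by
  have h1 := PresentedFrame.mk_le_mk (CompletionRel.inf_le (𝒰 := 𝒰) a b)
  have h2 := PresentedFrame.mk_le_mk (CompletionRel.le_inf (𝒰 := 𝒰) a b)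
  rw [map_inf] at h1 h2
  exact le_antisymm h1 h2

theorem mem_bot : mem 𝒰 ⊥ = ⊥ := by
  have := PresentedFrame.mk_le_mk (CompletionRel.proper (𝒰 := 𝒰) ⊥)
  simp only [lt_self_iff_false, iSup_false, map_bot] at this
  exact le_bot_iff.1 this

theorem mem_mono : Monotone (mem 𝒰) := fun a b h => by
  rw [← inf_eq_left.2 h, mem_inf]
  exact inf_le_right

theorem iSup_mem {U : Set L} (hU : U ∈ 𝒰.covers) : ⨆ u ∈ U, mem 𝒰 u = ⊤ := by
  have := PresentedFrame.mk_le_mk (CompletionRel.cauchy U hU)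
  simp only [map_iSup, map_top] at this
  exact top_le_iff.1 this

theorem mem_le_iSup (a : L) :
    mem 𝒰 a ≤ ⨆ (b : L) (_ : 𝒰.UniformlyBelow b a), mem 𝒰 b := by
  have := PresentedFrame.mk_le_mk (CompletionRel.regular (𝒰 := 𝒰) a)
  simp only [map_iSup] at this
  exact this

theorem finset_inf_mem (S : Finset L) : S.inf (mem 𝒰) = mem 𝒰 (S.inf id) := by
  classical
  induction S using Finset.induction_on with
  | empty => exact (mem_top 𝒰).symm
  | insert a s _ ih => rw [Finset.inf_insert, Finset.inf_insert, ih, mem_inf, id]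

theorem exists_eq_iSup (x : 𝒰.Completion) :
    ∃ s : Set (Finset L), x = ⨆ S ∈ s, mem 𝒰 (S.inf id) := by
  obtain ⟨a, ha⟩ := PresentedFrame.eq_iSup x
  refine ⟨{S | OrderDual.toDual S ∈ a}, ha.trans ?_⟩
  exact iSup_congr fun S => iSup_congr fun _ => finset_inf_mem 𝒰 _

end PreUniformity.Completion

/-! ### The triquotiency assignment of the limit map -/

section LimitAssignment

open PreUniformity PreUniformity.Completion

variable {L : Type u} {B : Set (Set L)}

/-- The indices `n` of the terms `s(n)` restricted by a finite set of generators. -/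
def seqSupport (S : Finset (CauchyGen B)) : Set ℕ := {n | ∃ u, CauchyGen.seq n u ∈ S}

theorem finite_seqSupport (S : Finset (CauchyGen B)) : (seqSupport S).Finite := by
  -- The value 0 on modulus generators is arbitrary: only an inclusion is needed.
  have : seqSupport S ⊆ (fun g : CauchyGen B => CauchyGen.casesOn g (fun n _ => n) fun _ _ => 0) ''
      (S : Set (CauchyGen B)) := fun n ⟨u, hu⟩ => ⟨_, hu, rfl⟩
  exact (S.finite_toSet.image _).subset this

theorem exists_gt_seqSupport (S : Finset (CauchyGen B)) : ∃ k, ∀ n ∈ seqSupport S, n < k := by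
  obtain ⟨k, hk⟩ := (finite_seqSupport S).bddAbove
  exact ⟨k + 1, fun n hn => Nat.lt_succ_of_le (hk hn)⟩

open Classical in
theorem seqSupport_insert_modulus (S : Finset (CauchyGen B)) (U : B) (k : ℕ) :
    seqSupport (insert (.modulus U k) S) = seqSupport S := by
  simp [seqSupport]

variable [Order.Frame L]

/-- The open to which a finite set of generators restricts the term `s(n)`. -/
def seqPart (S : Finset (CauchyGen B)) (n : ℕ) : L := ⨅ (u : L) (_ : CauchyGen.seq n u ∈ S), u

theorem seqPart_le {S : Finset (CauchyGen B)} {n : ℕ} {u : L} (h : CauchyGen.seq n u ∈ S) :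
    seqPart S n ≤ u := iInf₂_le u h

theorem le_seqPart {S : Finset (CauchyGen B)} {n : ℕ} {x : L}
    (h : ∀ u, CauchyGen.seq n u ∈ S → x ≤ u) : x ≤ seqPart S n := le_iInf₂ h

/-- The families `v` over which the join defining `q_#` on a basic open is taken. -/
structure IsAdmissible (S : Finset (CauchyGen B)) (v : ℕ → L) : Prop where
  mem_cover : ∀ n ∈ seqSupport S, v n ∈ ⋃₀ B
  meets_part : ∀ n ∈ seqSupport S, Meets (v n) (seqPart S n)
  exists_star : ∀ (U : B) (k : ℕ), CauchyGen.modulus U k ∈ S → ∃ V ∈ B,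
    Refines (starCover V) U ∧ ∀ n ∈ seqSupport S, k ≤ n → v n ∈ lowerClosure V

/-- A constraint of `T` may be implied by `v n` together with `S`, not by `S` alone; the Cauchy
relation needs this freedom. -/
theorem IsAdmissible.of_le {S T : Finset (CauchyGen B)} {v : ℕ → L} (h : IsAdmissible S v)
    (hsupp : seqSupport T ⊆ seqSupport S)
    (hpart : ∀ n ∈ seqSupport T, ∀ u, CauchyGen.seq n u ∈ T → seqPart S n ⊓ v n ≤ u)
    (hmod : ∀ U k, CauchyGen.modulus U k ∈ T → CauchyGen.modulus U k ∈ S) :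
    IsAdmissible T v where
  mem_cover n hn := h.mem_cover n (hsupp hn)
  meets_part n hn := by
    have h1 := h.meets_part n (hsupp hn)
    have h2 := le_seqPart (hpart n hn)
    refine lt_of_lt_of_le h1 (le_inf inf_le_left ?_)
    rwa [inf_comm]
  exists_star U k hU := by
    obtain ⟨V, hV, hVU, hv⟩ := h.exists_star U k (hmod U k hU)
    exact ⟨V, hV, hVU, fun n hn => hv n (hsupp hn)⟩

variable (𝒰 : PreUniformity L)

/-- The meet of the opens `[v n ∈ F]` over the indices restricted by `S`. -/
def familyOpen (S : Finset (CauchyGen B)) (v : ℕ → L) : 𝒰.Completion :=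
  ⨅ n ∈ seqSupport S, mem 𝒰 (v n)

/-- The value of `q_#` on the meet of a finite set of generators. -/
def assignmentValue (S : Finset (CauchyGen B)) : 𝒰.Completion :=
  ⨆ (v : ℕ → L) (_ : IsAdmissible S v), familyOpen 𝒰 S v

variable {𝒰}

theorem familyOpen_anti {S T : Finset (CauchyGen B)} (h : seqSupport T ⊆ seqSupport S)
    (v : ℕ → L) : familyOpen 𝒰 S v ≤ familyOpen 𝒰 T v :=
  biInf_mono h

theorem familyOpen_le {S : Finset (CauchyGen B)} {v : ℕ → L} {n : ℕ} (h : n ∈ seqSupport S) :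
    familyOpen 𝒰 S v ≤ mem 𝒰 (v n) := iInf₂_le n h

theorem IsAdmissible.familyOpen_le_of_le {S T : Finset (CauchyGen B)} {v : ℕ → L}
    (h : IsAdmissible S v) (hsupp : seqSupport T ⊆ seqSupport S)
    (hpart : ∀ n ∈ seqSupport T, ∀ u, CauchyGen.seq n u ∈ T → seqPart S n ⊓ v n ≤ u)
    (hmod : ∀ U k, CauchyGen.modulus U k ∈ T → CauchyGen.modulus U k ∈ S) :
    familyOpen 𝒰 S v ≤ assignmentValue 𝒰 T :=
  (familyOpen_anti hsupp v).trans (le_iSup₂_of_le v (h.of_le hsupp hpart hmod) le_rfl)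

theorem assignmentValue_anti : Antitone (assignmentValue (B := B) 𝒰) := fun _ _ hTS =>
  iSup₂_le fun _ hv => hv.familyOpen_le_of_le (fun _ ⟨u, hu⟩ => ⟨u, hTS hu⟩)
    (fun _ _ _ hu => inf_le_left.trans (seqPart_le (hTS hu))) fun _ _ hU => hTS hU

theorem PreUniformity.IsBase.exists_refines_finset (hB : 𝒰.IsBase B) {ι : Type*} (s : Finset ι)
    (p : ι → Set L → Prop) (hp : ∀ i ∈ s, ∃ V ∈ B, p i V) :
    ∃ W ∈ B, ∀ i ∈ s, ∃ V ∈ B, p i V ∧ Refines W V := by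
  classical
  induction s using Finset.induction_on with
  | empty =>
    obtain ⟨W, hW⟩ := hB.exists_mem
    exact ⟨W, hW, by simp⟩
  | insert a s _ ih =>
    obtain ⟨W, hW, h⟩ := ih fun i hi => hp i (Finset.mem_insert_of_mem hi)
    obtain ⟨V, hV, hpV⟩ := hp a (Finset.mem_insert_self a s)
    obtain ⟨W', hW', h1, h2⟩ := hB.directed hW hV
    refine ⟨W', hW', fun i hi => ?_⟩
    rcases Finset.mem_insert.1 hi with rfl | hi
    · exact ⟨V, hV, hpV, h2⟩
    · obtain ⟨V', hV', hp', h'⟩ := h i hi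
      exact ⟨V', hV', hp', h1.trans h'⟩

open Classical in
/-- Restricting one more term of the sequence. -/
theorem IsAdmissible.familyOpen_inf_mem_le (hB : 𝒰.IsBase B) {S : Finset (CauchyGen B)}
    {v : ℕ → L} (h : IsAdmissible S v) {n : ℕ} (hn : n ∉ seqSupport S) (u : L) :
    familyOpen 𝒰 S v ⊓ mem 𝒰 u ≤ assignmentValue 𝒰 (insert (.seq n u) S) := by
  -- The new value is drawn from a cover `W` refining all star witnesses at once, so it satisfies
  -- every modulus condition whatever the size of `n`.
  obtain ⟨W, hW, hWV⟩ := hB.exists_refines_finset S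
    (fun g V => ∀ U k, g = .modulus U k → Refines (starCover V) U ∧
      ∀ n ∈ seqSupport S, k ≤ n → v n ∈ lowerClosure V) (by
    intro g hg
    cases g with
    | seq n u =>
      obtain ⟨V, hV⟩ := hB.exists_mem
      exact ⟨V, hV, fun U k h => by cases h⟩
    | modulus U k =>
      obtain ⟨V, hV, h'⟩ := h.exists_star U k hg
      exact ⟨V, hV, fun U k h => by cases h; exact h'⟩)
  have hsupp : ∀ m, m ∈ seqSupport (insert (CauchyGen.seq n u) S) ↔ m = n ∨ m ∈ seqSupport S := by
    intro m
    simp [seqSupport, exists_or]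
  have hv : ∀ (w : L), ∀ m ∈ seqSupport S, Function.update v n w m = v m := fun w m hm =>
    Function.update_of_ne (fun h : m = n => hn (h ▸ hm)) _ _
  rw [← inf_top_eq (mem 𝒰 u), ← iSup_mem 𝒰 (hB.1 hW), inf_iSup₂_eq, inf_iSup₂_eq]
  refine iSup₂_le fun w hw => ?_
  rw [← mem_inf]
  -- Members of `W` disjoint from `u` contribute nothing, because `F` is proper.
  by_cases hwu : Meets w u
  swap
  · rw [inf_comm u, not_meets.1 hwu, mem_bot, inf_bot_eq]
    exact bot_le
  refine le_iSup₂_of_le (Function.update v n w) ⟨?_, ?_, ?_⟩ ?_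
  · intro m hm
    rcases (hsupp m).1 hm with rfl | hm
    · rw [Function.update_self]
      exact ⟨W, hW, hw⟩
    · rw [hv w m hm]
      exact h.mem_cover m hm
  · intro m hm
    rcases (hsupp m).1 hm with rfl | hm
    · rw [Function.update_self]
      refine hwu.mono le_rfl (le_seqPart fun y hy => ?_)
      rcases Finset.mem_insert.1 hy with hy | hy
      · cases hy; exact le_rfl
      · exact absurd ⟨y, hy⟩ hn
    · rw [hv w m hm]
      refine (h.meets_part m hm).mono le_rfl (le_seqPart fun y hy => ?_)
      rcases Finset.mem_insert.1 hy with hy | hy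
      · cases hy; exact absurd hm hn
      · exact seqPart_le hy
  · intro U k hU
    have hU' : CauchyGen.modulus U k ∈ S := by simpa using hU
    obtain ⟨V, hV, hVU, hWV⟩ := hWV _ hU'
    obtain ⟨hVU, hvV⟩ := hVU U k rfl
    refine ⟨V, hV, hVU, fun m hm hkm => ?_⟩
    rcases (hsupp m).1 hm with rfl | hm
    · rw [Function.update_self]
      exact mem_lowerClosure.2 (hWV w hw)
    · rw [hv w m hm]
      exact hvV m hm hkm
  · refine le_iInf₂ fun m hm => ?_
    rcases (hsupp m).1 hm with rfl | hm
    · rw [Function.update_self]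
      exact inf_le_right.trans (mem_mono 𝒰 inf_le_right)
    · rw [hv w m hm]
      exact inf_le_left.trans (familyOpen_le hm)

/-! ### Compatibility with the relations for modulated Cauchy sequences -/

open Classical in
-- A trivial constraint still enlarges the support, so admissible families must be extended to the
-- new index.
theorem assignmentValue_le_insert_top (hB : 𝒰.IsBase B) (S : Finset (CauchyGen B)) (n : ℕ) :
    assignmentValue 𝒰 S ≤ assignmentValue 𝒰 (insert (.seq n ⊤) S) := by
  refine iSup₂_le fun v hv => ?_
  by_cases hn : n ∈ seqSupport S
  · refine hv.familyOpen_le_of_le ?_ ?_ (by simp)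
    · rintro m ⟨u, hu⟩
      rcases Finset.mem_insert.1 hu with hu | hu
      · cases hu; exact hn
      · exact ⟨u, hu⟩
    · rintro m - u hu
      rcases Finset.mem_insert.1 hu with hu | hu
      · cases hu; exact le_top
      · exact inf_le_left.trans (seqPart_le hu)
  · simpa [mem_top] using hv.familyOpen_inf_mem_le hB hn ⊤

open Classical in
theorem seqPart_insert_modulus (S : Finset (CauchyGen B)) (U : B) (k : ℕ) :
    seqPart (insert (.modulus U k) S) = seqPart S := by
  funext n
  simp [seqPart]

open Classical in
/-- A modulus larger than all restricted indices imposes no condition. -/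
theorem IsAdmissible.insert_modulus (hB : 𝒰.IsBase B) {S : Finset (CauchyGen B)} {v : ℕ → L}
    (h : IsAdmissible S v) (U : B) {k : ℕ} (hk : ∀ n ∈ seqSupport S, n < k) :
    IsAdmissible (insert (.modulus U k) S) v where
  mem_cover n hn := h.mem_cover n (by rwa [seqSupport_insert_modulus] at hn)
  meets_part n hn := by
    rw [seqPart_insert_modulus]
    exact h.meets_part n (by rwa [seqSupport_insert_modulus] at hn)
  exists_star U' k' hU := by
    rw [seqSupport_insert_modulus]
    rcases Finset.mem_insert.1 hU with hU | hU
    · cases hU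
      obtain ⟨V, hV, hVU⟩ := hB.exists_star_refines (hB.1 U.2)
      exact ⟨V, hV, hVU, fun n hn hkn => absurd (hk n hn) (not_lt.2 hkn)⟩
    · exact h.exists_star U' k' hU

open Classical in
theorem assignmentValue_le_iSup_modulus (hB : 𝒰.IsBase B) (S : Finset (CauchyGen B)) (U : B) :
    assignmentValue 𝒰 S ≤ ⨆ k, assignmentValue 𝒰 (insert (.modulus U k) S) := by
  obtain ⟨k, hk⟩ := exists_gt_seqSupport S
  refine iSup₂_le fun v hv => le_iSup_of_le k ?_
  refine le_iSup₂_of_le v (hv.insert_modulus hB U hk) ?_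
  exact familyOpen_anti (seqSupport_insert_modulus S U k).subset v

open Classical in
theorem assignmentValue_union_seq_le (hB : 𝒰.IsBase B) (S : Finset (CauchyGen B)) (n : ℕ)
    {T : Finset L} {x : L} (hx : T.inf id ≤ x) :
    assignmentValue 𝒰 (S ∪ T.image (.seq n)) ≤ assignmentValue 𝒰 (S ∪ {.seq n x}) := by
  -- When `T` is empty the left side may not constrain `s(n)` at all, so `n` is first put in the
  -- support.
  refine (assignmentValue_le_insert_top hB _ n).trans (iSup₂_le fun v hv => ?_)
  refine hv.familyOpen_le_of_le ?_ ?_ ?_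
  · rintro m ⟨u, hu⟩
    rcases Finset.mem_union.1 hu with hu | hu
    · exact ⟨u, by simp [hu]⟩
    · cases Finset.mem_singleton.1 hu
      exact ⟨⊤, by simp⟩
  · rintro m - u hu
    rcases Finset.mem_union.1 hu with hu | hu
    · exact inf_le_left.trans (seqPart_le (by simp [hu]))
    · cases Finset.mem_singleton.1 hu
      refine inf_le_left.trans (le_trans (Finset.le_inf fun y hy => ?_) hx)
      exact seqPart_le (by simp [hy])
  · intro U k hU
    simpa using hU

open Classical in
theorem assignmentValue_union_seq_iSup_le (S : Finset (CauchyGen B)) (n : ℕ)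
    (𝓕 : Set (Finset L)) :
    assignmentValue 𝒰 (S ∪ {.seq n (⨆ T ∈ 𝓕, T.inf id)}) ≤
      ⨆ T ∈ 𝓕, assignmentValue 𝒰 (S ∪ T.image (.seq n)) := by
  refine iSup₂_le fun v hv => ?_
  have hn : n ∈ seqSupport (S ∪ {CauchyGen.seq n (⨆ T ∈ 𝓕, T.inf id)}) :=
    ⟨⨆ T ∈ 𝓕, T.inf id, by simp⟩
  -- The part of `v n` allowed by all constraints is nonzero and lies below the join, hence meets
  -- one of its members; that member selects `T`, with the same `v`.
  have h1 : Meets (v n ⊓ seqPart (S ∪ {CauchyGen.seq n (⨆ T ∈ 𝓕, T.inf id)}) n)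
      (sSup ((fun T : Finset L => T.inf id) '' 𝓕)) := by
    have hle : seqPart (S ∪ {CauchyGen.seq n (⨆ T ∈ 𝓕, T.inf id)}) n ≤ ⨆ T ∈ 𝓕, T.inf id :=
      seqPart_le (Finset.mem_union_right _ (Finset.mem_singleton_self _))
    rw [sSup_image, Meets, inf_assoc, inf_eq_left.2 hle]
    exact hv.meets_part n hn
  obtain ⟨_, ⟨T, hT, rfl⟩, hvT⟩ := meets_sSup.1 h1
  refine le_iSup₂_of_le T hT ?_
  have hsupp : seqSupport (S ∪ T.image (.seq n)) ⊆
      seqSupport (S ∪ {CauchyGen.seq n (⨆ T ∈ 𝓕, T.inf id)}) := by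
    rintro m ⟨u, hu⟩
    rcases Finset.mem_union.1 hu with hu | hu
    · exact ⟨u, by simp [hu]⟩
    · obtain ⟨y, -, hy⟩ := Finset.mem_image.1 hu
      cases hy
      exact hn
  refine (familyOpen_anti hsupp v).trans (le_iSup₂_of_le v ⟨?_, ?_, ?_⟩ le_rfl)
  · exact fun m hm => hv.mem_cover m (hsupp hm)
  · intro m hm
    have hle : ∀ u, CauchyGen.seq m u ∈ S →
        seqPart (S ∪ {CauchyGen.seq n (⨆ T ∈ 𝓕, T.inf id)}) m ≤ u := fun u hu =>
      seqPart_le (by simp [hu])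
    by_cases hmn : m = n
    · subst hmn
      refine lt_of_lt_of_le hvT (le_inf (inf_le_left.trans inf_le_left) (le_seqPart fun u hu => ?_))
      rcases Finset.mem_union.1 hu with hu | hu
      · exact inf_le_left.trans (inf_le_right.trans (hle u hu))
      · obtain ⟨y, hyT, hy⟩ := Finset.mem_image.1 hu
        cases hy
        exact inf_le_right.trans (Finset.inf_le hyT)
    · refine (hv.meets_part m (hsupp hm)).mono le_rfl (le_seqPart fun u hu => ?_)
      rcases Finset.mem_union.1 hu with hu | hu
      · exact hle u hu
      · obtain ⟨y, -, hy⟩ := Finset.mem_image.1 hu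
        cases hy
        exact absurd rfl hmn
  · intro U k hU
    obtain ⟨V, hV, hVU, h⟩ := hv.exists_star U k (by simpa using hU)
    exact ⟨V, hV, hVU, fun m hm => h m (hsupp hm)⟩

open Classical in
theorem assignmentValue_modulus_le (hB : 𝒰.IsBase B) (S : Finset (CauchyGen B)) (U : B)
    {k n n' : ℕ} (hn : k ≤ n) (hn' : k ≤ n') :
    assignmentValue 𝒰 (S ∪ {.modulus U k}) ≤
      ⨆ u ∈ (U : Set L), assignmentValue 𝒰 (S ∪ {.seq n u, .seq n' u}) := by
  refine (assignmentValue_le_insert_top hB _ n).trans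
    ((assignmentValue_le_insert_top hB _ n').trans (iSup₂_le fun v hv => ?_))
  generalize hS' : insert (CauchyGen.seq n' ⊤) (insert (CauchyGen.seq n ⊤)
    (S ∪ {CauchyGen.modulus U k})) = S' at hv
  have hnS : n ∈ seqSupport S' := ⟨⊤, by simp [← hS']⟩
  have hnS' : n' ∈ seqSupport S' := ⟨⊤, by simp [← hS']⟩
  have hSS : ∀ g ∈ S, g ∈ S' := fun g hg => by simp [← hS', hg]
  -- Disjoint values cannot both belong to a proper filter. Values that meet lie in members of `V`
  -- that meet, hence in one `u` of `U`, and the new constraints are then implied by `v`.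
  by_cases hvv : Meets (v n) (v n')
  swap
  · refine le_trans (b := mem 𝒰 (v n) ⊓ mem 𝒰 (v n'))
      (le_inf (familyOpen_le hnS) (familyOpen_le hnS')) ?_
    rw [← mem_inf, not_meets.1 hvv, mem_bot]
    exact bot_le
  obtain ⟨V, hV, hVU, h⟩ := hv.exists_star U k (by simp [← hS'])
  obtain ⟨p, hp, hvp⟩ := mem_lowerClosure.1 (h n hnS hn)
  obtain ⟨p', hp', hvp'⟩ := mem_lowerClosure.1 (h n' hnS' hn')
  obtain ⟨u, hu, H⟩ := exists_le_of_meets hVU hp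
  have hpp' : Meets p p' := hvv.mono hvp hvp'
  have hpp : Meets p p := meets_self (lt_of_lt_of_le hpp' inf_le_left)
  refine le_iSup₂_of_le u hu (hv.familyOpen_le_of_le ?_ ?_ ?_)
  · rintro m ⟨y, hy⟩
    simp only [Finset.mem_union, Finset.mem_insert, Finset.mem_singleton] at hy
    rcases hy with hy | hy | hy
    · exact ⟨y, hSS _ hy⟩
    · cases hy; exact hnS
    · cases hy; exact hnS'
  · rintro m - y hy
    simp only [Finset.mem_union, Finset.mem_insert, Finset.mem_singleton] at hy
    rcases hy with hy | hy | hy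
    · exact inf_le_left.trans (seqPart_le (hSS _ hy))
    · cases hy; exact inf_le_right.trans (hvp.trans (H p hp hpp))
    · cases hy; exact inf_le_right.trans (hvp'.trans (H p' hp' hpp'))
  · intro U' k' hU
    exact hSS _ (by simpa using hU)

theorem exists_assignment (hB : 𝒰.IsBase B) : ∃ g : sSupHom (CauchyFrame B) 𝒰.Completion,
    ∀ S : Finset (CauchyGen B),
      g (S.inf (PresentedFrame.gen (CauchyRel B))) = assignmentValue 𝒰 S := by
  classical
  refine PresentedFrame.exists_sSupHom _ assignmentValue_anti fun a b hab S => ?_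
  have hφ : Monotone (assignmentValue (B := B) 𝒰 ∘ OrderDual.ofDual) := fun _ _ h =>
    assignmentValue_anti h
  have hfin : ∀ T : Finset (CauchyGen B),
      lowerSetExtend (assignmentValue 𝒰 ∘ OrderDual.ofDual)
        (T.inf FreeFrame.gen ⊓ LowerSet.Iic (OrderDual.toDual S)) = assignmentValue 𝒰 (S ∪ T) :=
    fun T => by
      rw [FreeFrame.Iic_inf_finset_inf, lowerSetExtend_Iic hφ]
      rfl
  have hgen : ∀ g : CauchyGen B,
      lowerSetExtend (assignmentValue 𝒰 ∘ OrderDual.ofDual)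
        (FreeFrame.gen g ⊓ LowerSet.Iic (OrderDual.toDual S)) = assignmentValue 𝒰 (S ∪ {g}) :=
    fun g => by
      rw [← hfin, Finset.inf_singleton]
  have himg : ∀ (n : ℕ) (T : Finset L), (T.inf fun u => FreeFrame.gen (CauchyGen.seq (B := B) n u)) =
      (T.image (CauchyGen.seq n)).inf FreeFrame.gen := fun n T => by
    rw [Finset.inf_image]
    rfl
  cases hab with
  | seq_le n 𝓕 =>
    simp only [iSup_inf_eq, map_iSup, himg, hfin, hgen]
    exact iSup₂_le fun T hT => assignmentValue_union_seq_le hB S n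
      (le_iSup₂ (f := fun (T : Finset L) (_ : T ∈ 𝓕) => T.inf id) T hT)
  | le_seq n 𝓕 =>
    simp only [iSup_inf_eq, map_iSup, himg, hfin, hgen]
    exact assignmentValue_union_seq_iSup_le S n 𝓕
  | total U =>
    simp only [iSup_inf_eq, map_iSup, hgen, top_inf_eq, lowerSetExtend_Iic hφ, Finset.union_comm S,
      ← Finset.insert_eq]
    exact assignmentValue_le_iSup_modulus hB S U
  | cauchy U k n n' hn hn' =>
    have hpair : ∀ u, FreeFrame.gen (CauchyGen.seq n u) ⊓ FreeFrame.gen (CauchyGen.seq n' u) =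
        ({CauchyGen.seq n u, CauchyGen.seq n' u} : Finset (CauchyGen B)).inf FreeFrame.gen :=
      fun u => by simp
    simp only [iSup_inf_eq, map_iSup, hpair, hfin, hgen]
    exact assignmentValue_modulus_le hB S U hn hn'

end LimitAssignment

/-! ### Normal forms, uniqueness and the Frobenius law -/

section LimitAssignment

open PreUniformity PreUniformity.Completion

variable {L : Type u} [Order.Frame L] {B : Set (Set L)}

theorem CauchyFrame.finset_inf_gen_le (S : Finset (CauchyGen B)) (n : ℕ) :
    S.inf (PresentedFrame.gen (CauchyRel B)) ≤ CauchyFrame.seq B n (seqPart S n) := by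
  have hinj : Set.InjOn (CauchyGen.seq (B := B) n) (CauchyGen.seq n ⁻¹' (S : Set (CauchyGen B))) :=
    fun _ _ _ _ h => by cases h; rfl
  have h : seqPart S n = (S.preimage (CauchyGen.seq n) hinj).inf id := by
    simp only [seqPart, Finset.inf_eq_iInf, Finset.mem_preimage, id]
  rw [h, CauchyFrame.seq_finset_inf]
  exact Finset.le_inf fun u hu => Finset.inf_le (Finset.mem_preimage.1 hu)

/-- A finite meet of generators is a meet restricting distinct terms of the sequence. -/
theorem CauchyFrame.finset_inf_gen_eq (S : Finset (CauchyGen B)) :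
    ∃ (p r : ℕ) (n : Fin p → ℕ) (u : Fin p → L) (U : Fin r → B) (k : Fin r → ℕ),
      Function.Injective n ∧ S.inf (PresentedFrame.gen (CauchyRel B)) =
        (⨅ i, CauchyFrame.seq B (n i) (u i)) ⊓ ⨅ j, CauchyFrame.modulus B (U j) (k j) := by
  let N := (finite_seqSupport S).toFinset
  let f : B × ℕ → CauchyGen B := fun x => .modulus x.1 x.2
  have hf : Function.Injective f := fun x y h => by cases x; cases y; cases h; rfl
  let M : Finset (B × ℕ) := S.preimage f hf.injOn
  have hM : ∀ x ∈ M, CauchyGen.modulus x.1 x.2 ∈ S := fun x hx =>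
    (Finset.mem_preimage (f := f)).1 hx
  refine ⟨N.card, M.card, fun i => N.equivFin.symm i, fun i => seqPart S (N.equivFin.symm i),
    fun j => (M.equivFin.symm j).1.1, fun j => (M.equivFin.symm j).1.2,
    fun i j h => N.equivFin.symm.injective (Subtype.ext h), le_antisymm ?_ ?_⟩
  · refine le_inf (le_iInf fun i => finset_inf_gen_le S _) (le_iInf fun j => ?_)
    exact Finset.inf_le (hM _ (M.equivFin.symm j).2)
  · refine Finset.le_inf fun g hg => ?_
    cases g with
    | seq n u =>
      have hn : n ∈ N := (Set.Finite.mem_toFinset _).2 ⟨u, hg⟩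
      refine inf_le_left.trans (iInf_le_of_le (N.equivFin ⟨n, hn⟩) ?_)
      simp only [Equiv.symm_apply_apply]
      exact seq_mono n (seqPart_le hg)
    | modulus U k =>
      have hU : (U, k) ∈ M := (Finset.mem_preimage (f := f)).2 hg
      refine inf_le_right.trans (iInf_le_of_le (M.equivFin ⟨(U, k), hU⟩) ?_)
      simp only [Equiv.symm_apply_apply]
      exact le_rfl

variable {𝒰 : PreUniformity L}

theorem IsLimitAssignment.unique {g h : sSupHom (CauchyFrame B) 𝒰.Completion}
    (hg : IsLimitAssignment 𝒰 B g) (hh : IsLimitAssignment 𝒰 B h) : g = h := by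
  have key : ∀ S : Finset (CauchyGen B), g (S.inf (PresentedFrame.gen (CauchyRel B))) =
      h (S.inf (PresentedFrame.gen (CauchyRel B))) := by
    intro S
    obtain ⟨p, r, n, u, U, k, hn, hS⟩ := CauchyFrame.finset_inf_gen_eq S
    rw [hS]
    by_cases hu : ∀ i, ⊥ < u i
    · rw [hg p r n u U k hn hu, hh p r n u U k hn hu]
    -- The defining equation says nothing when some `u i` is zero, but the open itself is then zero.
    · obtain ⟨i, hi⟩ := not_forall.1 hu
      rw [bot_lt_iff_ne_bot, not_not] at hi
      have : (⨅ i, CauchyFrame.seq B (n i) (u i)) = ⊥ :=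
        le_bot_iff.1 (iInf_le_of_le i (by rw [hi, CauchyFrame.seq_bot]))
      rw [this, bot_inf_eq, map_bot, map_bot]
  ext x
  obtain ⟨a, rfl⟩ := PresentedFrame.eq_iSup x
  simp only [map_iSup, key]

theorem isLimitAssignment_of_apply {g : sSupHom (CauchyFrame B) 𝒰.Completion}
    (hg : ∀ S : Finset (CauchyGen B),
      g (S.inf (PresentedFrame.gen (CauchyRel B))) = assignmentValue 𝒰 S) :
    IsLimitAssignment 𝒰 B g := by
  classical
  intro p r n u U k hn hu
  let S : Finset (CauchyGen B) := (Finset.univ.image fun i => CauchyGen.seq (n i) (u i)) ∪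
    Finset.univ.image fun j => CauchyGen.modulus (U j) (k j)
  have hS : S.inf (PresentedFrame.gen (CauchyRel B)) =
      (⨅ i, CauchyFrame.seq B (n i) (u i)) ⊓ ⨅ j, CauchyFrame.modulus B (U j) (k j) := by
    simp only [S, Finset.inf_union, Finset.inf_image, Finset.inf_univ_eq_iInf]
    rfl
  have hseq : ∀ m y, CauchyGen.seq m y ∈ S ↔ ∃ i, n i = m ∧ u i = y := by
    intro m y
    simp [S]
  have hmod : ∀ j, CauchyGen.modulus (U j) (k j) ∈ S := fun j => by
    simpa [S] using ⟨j, rfl, rfl⟩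
  have hsupp : ∀ i, n i ∈ seqSupport S := fun i => ⟨u i, (hseq _ _).2 ⟨i, rfl, rfl⟩⟩
  have hpart : ∀ i, seqPart S (n i) = u i := fun i => le_antisymm
    (seqPart_le ((hseq _ _).2 ⟨i, rfl, rfl⟩)) (le_seqPart fun y hy => by
      obtain ⟨i', hi, rfl⟩ := (hseq _ _).1 hy
      rw [hn hi])
  rw [← hS, hg]
  apply le_antisymm
  · refine iSup₂_le fun v hv => ?_
    choose V hV hVU h using fun j => hv.exists_star (U j) (k j) (hmod j)
    refine le_iSup_of_le (fun j => ⟨V j, hV j⟩) <| le_iSup_of_le hVU <|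
      le_iSup_of_le (fun i => v (n i)) <| le_iSup_of_le (fun i => hv.mem_cover _ (hsupp i)) <|
      le_iSup_of_le (fun i j hij => h j _ (hsupp i) hij) <| le_iSup_of_le (fun i => ?_) <|
      le_iInf fun i => familyOpen_le (hsupp i)
    rw [← hpart i]
    exact hv.meets_part _ (hsupp i)
  · refine iSup_le fun V => iSup_le fun hVU => iSup_le fun v => iSup_le fun hv =>
      iSup_le fun hvV => iSup_le fun hvu => ?_
    -- The default `⊥` is never inspected: admissibility only concerns indices in the support, which
    -- are the `n i`.
    have hext : ∀ i, Function.extend n v (fun _ => ⊥) (n i) = v i := fun i => hn.extend_apply _ _ i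
    refine le_iSup₂_of_le (Function.extend n v fun _ => ⊥) ⟨?_, ?_, ?_⟩ ?_
    · rintro m ⟨y, hy⟩
      obtain ⟨i, rfl, rfl⟩ := (hseq _ _).1 hy
      rw [hext]
      exact hv i
    · rintro m ⟨y, hy⟩
      obtain ⟨i, rfl, rfl⟩ := (hseq _ _).1 hy
      rw [hext, hpart]
      exact hvu i
    · intro U' k' hU
      obtain ⟨j, rfl, rfl⟩ : ∃ j, U j = U' ∧ k j = k' := by simpa [S] using hU
      refine ⟨V j, (V j).2, hVU j, ?_⟩
      rintro m ⟨y, hy⟩ hm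
      obtain ⟨i, rfl, rfl⟩ := (hseq _ _).1 hy
      rw [hext]
      exact hvV i j hm
    · refine le_iInf₂ ?_
      rintro m ⟨y, hy⟩
      obtain ⟨i, rfl, rfl⟩ := (hseq _ _).1 hy
      rw [hext]
      exact iInf_le _ i

theorem existsUnique_isLimitAssignment (hB : 𝒰.IsBase B) :
    ∃! g : sSupHom (CauchyFrame B) 𝒰.Completion, IsLimitAssignment 𝒰 B g := by
  obtain ⟨g, hg⟩ := exists_assignment hB
  exact ⟨g, isLimitAssignment_of_apply hg, fun h hh => hh.unique (isLimitAssignment_of_apply hg)⟩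

theorem IsLimitAssignment.apply (hB : 𝒰.IsBase B) {g : sSupHom (CauchyFrame B) 𝒰.Completion}
    (hg : IsLimitAssignment 𝒰 B g) (S : Finset (CauchyGen B)) :
    g (S.inf (PresentedFrame.gen (CauchyRel B))) = assignmentValue 𝒰 S := by
  obtain ⟨h, hh⟩ := exists_assignment hB
  rw [hg.unique (isLimitAssignment_of_apply hh), hh]

open Classical in
-- For admissible `w`, the open `w k` lies in a member of `U` and meets `v`, so it lies below the
-- star of `v`, hence below `u`.
theorem assignmentValue_insert_le {S : Finset (CauchyGen B)} {U : B} {k' k : ℕ} (hk : k' ≤ k)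
    {v u : L} (h : StarBelow (U : Set L) v u) :
    assignmentValue 𝒰 (insert (.modulus U k') (insert (.seq k v) S)) ≤ mem 𝒰 u := by
  refine iSup₂_le fun w hw => ?_
  have hks : k ∈ seqSupport (insert (.modulus U k') (insert (.seq k v) S)) := ⟨v, by simp⟩
  refine (familyOpen_le hks).trans (mem_mono 𝒰 ?_)
  obtain ⟨V, hV, hVU, hwV⟩ := hw.exists_star U k' (by simp)
  obtain ⟨p, hp, hwp⟩ := mem_lowerClosure.1 (hwV k hks hk)
  obtain ⟨x, hx, H⟩ := exists_le_of_meets hVU hp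
  have hwv : Meets (w k) v := (hw.meets_part k hks).mono le_rfl (seqPart_le (by simp))
  have hpx : p ≤ x := H p hp (meets_self
    (lt_of_lt_of_le hwv (inf_le_left.trans hwp)))
  exact (hwp.trans hpx).trans ((le_starOf hx (hwv.symm.mono le_rfl (hwp.trans hpx))).trans h)

theorem IsLimitAssignment.apply_inf_limitOpen (hB : 𝒰.IsBase B)
    {g : sSupHom (CauchyFrame B) 𝒰.Completion} (hg : IsLimitAssignment 𝒰 B g)
    (S : Finset (CauchyGen B)) (u : L) :
    g (S.inf (PresentedFrame.gen (CauchyRel B)) ⊓ limitOpen 𝒰 B u) =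
      assignmentValue 𝒰 S ⊓ mem 𝒰 u := by
  classical
  have hins : ∀ (U : B) (k' k : ℕ) (v : L),
      S.inf (PresentedFrame.gen (CauchyRel B)) ⊓
        (CauchyFrame.modulus B U k' ⊓ CauchyFrame.seq B k v) =
      (insert (CauchyGen.modulus U k') (insert (CauchyGen.seq k v) S)).inf
        (PresentedFrame.gen (CauchyRel B)) := by
    intro U k' k v
    rw [Finset.inf_insert, Finset.inf_insert, inf_comm, inf_assoc]
    rfl
  apply le_antisymm
  · simp only [limitOpen, inf_iSup_eq, map_iSup, hins, hg.apply hB]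
    refine iSup_le fun U => iSup_le fun v => iSup_le fun u' => iSup_le fun h => iSup_le fun h' =>
      iSup_le fun k' => iSup_le fun k => iSup_le fun hk => le_inf ?_ ?_
    · exact assignmentValue_anti ((Finset.subset_insert _ _).trans (Finset.subset_insert _ _))
    · exact (assignmentValue_insert_le hk h).trans (mem_mono 𝒰 h'.le)
  · simp only [assignmentValue, iSup_inf_eq]
    refine iSup₂_le fun v hv => ?_
    -- Regularity is applied twice, giving `x ◁_U u' ◁ u` as in the limit formula. The fresh index
    -- `k` then serves both as the modulus of `U` and as the term placed in `x`.
    refine (inf_le_inf_left _ (mem_le_iSup 𝒰 u)).trans ?_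
    simp only [inf_iSup_eq]
    refine iSup₂_le fun u' hu' => ?_
    refine (inf_le_inf_left _ (mem_le_iSup 𝒰 u')).trans ?_
    simp only [inf_iSup_eq]
    refine iSup₂_le fun x hx => ?_
    obtain ⟨U, hU, hxU⟩ := hB.exists_starBelow hx
    obtain ⟨k, hk⟩ := exists_gt_seqSupport S
    have hadm := hv.insert_modulus hB ⟨U, hU⟩ hk
    have hle := hadm.familyOpen_inf_mem_le hB (n := k)
      (fun h => by
        rw [seqSupport_insert_modulus] at h
        exact lt_irrefl k (hk k h)) x
    rw [Finset.insert_comm, ← hg.apply hB, ← hins] at hle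
    refine (inf_le_inf_right _ (familyOpen_anti (seqSupport_insert_modulus S _ k).subset v)).trans
      (hle.trans (OrderHomClass.mono g (inf_le_inf_left _ ?_)))
    exact le_limitOpen ⟨U, hU⟩ hxU hu' le_rfl

theorem IsLimitAssignment.isTriquotiencyAssignment (hB : 𝒰.IsBase B)
    {q : FrameHom 𝒰.Completion (CauchyFrame B)} (hq : IsLimitMap 𝒰 B q)
    {g : sSupHom (CauchyFrame B) 𝒰.Completion} (hg : IsLimitAssignment 𝒰 B g) :
    IsTriquotiencyAssignment q g := by
  have hqu : ∀ u, q (mem 𝒰 u) = limitOpen 𝒰 B u := hq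
  refine ⟨?_, fun a b => ?_⟩
  · rw [← Finset.inf_empty (f := PresentedFrame.gen (CauchyRel B)), hg.apply hB, ← top_le_iff]
    have h0 : seqSupport (∅ : Finset (CauchyGen B)) = ∅ := by simp [seqSupport]
    -- With no generators any family is admissible, and its open is the empty meet.
    refine le_iSup₂_of_le (fun _ => ⊥) ⟨?_, ?_, ?_⟩ ?_ <;> simp [h0, familyOpen]
  · obtain ⟨s, rfl⟩ := PresentedFrame.eq_iSup a
    obtain ⟨t, rfl⟩ := exists_eq_iSup 𝒰 b
    simp only [map_iSup, iSup_inf_eq, inf_iSup_eq, hqu, hg.apply_inf_limitOpen hB, hg.apply hB]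

end LimitAssignment

theorem mainTheorem1 {L : Type u} [Order.Frame L] (𝒰 : PreUniformity L) (B : Set (Set L))
    (hB : 𝒰.IsBase B) :
    (∃! q : FrameHom 𝒰.Completion (CauchyFrame B), IsLimitMap 𝒰 B q) ∧
    (∃! g : sSupHom (CauchyFrame B) 𝒰.Completion, IsLimitAssignment 𝒰 B g) ∧
    ∀ (q : FrameHom 𝒰.Completion (CauchyFrame B)) (g : sSupHom (CauchyFrame B) 𝒰.Completion),
      IsLimitMap 𝒰 B q → IsLimitAssignment 𝒰 B g →
        IsTriquotiencyAssignment q g ∧ IsLowerTriquotient q ∧ IsStableQuotient (localeMap q) := by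
  refine ⟨existsUnique_isLimitMap hB, existsUnique_isLimitAssignment hB, fun q g hq hg => ?_⟩
  have h := hg.isTriquotiencyAssignment hB hq
  exact ⟨h, ⟨g, h⟩, h.isStableQuotient⟩
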